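/- **Setting.** Let $k,\sigma_0,\sigma_1>0$, $0<R_1<R_2$, $d=R_2-R_1$. Let $D\subset\mathbb R^2$ be a set (the scatterer, e.g. a bounded Lipschitz domain) with $\bar D\subset\{|x|<R_1\}$, let $f\in L^2(\mathbb R^2\setminus\bar D)$ vanish a.e. for $|x|>R_1$, and let $g$ be the trace on $\partial D$ of some $G\in H^1(\mathbb R^2)$ (for a Lipschitz domain: $g\in H^{1/2}(\partial D)$). Put $$S(r)=\begin{cases} r,& r\le R_1,\\ R_1+(\sigma_1+{\rm i}\sigma_0)\,T(r),& R_1<r<R_2,\end{cases}\qquad T(r)=\frac{(R_2-R_1)(r-R_1)}{R_2-r},\qquad \alpha=\frac{dS}{dr},\quad \beta=\frac{S}{r}.$$ Let $U_{\rm PAL}$ be a solution of the circular PAL problem: for every $\rho<R_2$ one has $U_{\rm PAL}\in H^1(\{|x|<\rho\}\setminus\bar D)$; the equation $$\frac1r\frac{\partial}{\partial r}\Big(\frac{\beta r}{\alpha}\frac{\partial U_{\rm PAL}}{\partial r}\Big)+\frac1{r^2}\frac{\alpha}{\beta}\frac{\partial^2U_{\rm PAL}}{\partial\theta^2}+\alpha\beta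 k^2U_{\rm PAL}=f$$ holds weakly in $\{|x|<R_2\}\setminus\bar D$, that is, against all test functions in $C_c^\infty(\{|x|<R_2\}\setminus\bar D)$ (which includes the transmission conditions at $r=R_1$); $U_{\rm PAL}=g$ on $\partial D$ in the sense that $U_{\rm PAL}-G$, on $\{|x|<R_1\}\setminus\bar D$, is an $H^1$-limit of functions from $C_c^\infty(\mathbb R^2\setminus\bar D)$; and $|U_{\rm PAL}|$ is uniformly bounded as $r\to R_2$. In the layer $R_1\le r<R_2$, $U_{\rm PAL}$ denotes the continuous representative. **Theorem.** For all $r\in[R_1,R_2)$, $$\int_0^{2\pi}|U_{\rm PAL}(r,\theta)|^2\,d\theta\le\exp\Big(-2\sigma_0\,d\,k\,\frac{\tau}{1-\tau}\big(1-h(\tau)(1-\tau)^2\big)^{1/2}\Big)\int_0^{2\pi}|U_{\rm PAL}(R_1,\theta)|^2\,d\theta,$$ where $$\tau=\frac{r-R_1}{R_2-R_1}\in[0,1),\qquad h(\tau)=\frac{R_1^2}{(R_1(1-\tau)+\sigma_1d\,\tau)^2+\sigma_0^2d^2\tau^2}.$$ In particular the solution decays exponentially toward $r=R_2$: $$\int_0^{2\pi}|U_{\rm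 PAL}(r,\theta)|^2\,d\theta=O\big(e^{-2\sigma_0dk/(1-\tau)}\big)\quad\text{as } r\to R_2^-.$$ -/

import Mathlib

open MeasureTheory Set Filter Topology Asymptotics
open scoped ContDiff

namespace PAL

/-! The plane is identified with `ℂ`, a point being `r e^{iθ}`; `volume` is Lebesgue measure. -/

/-- Smooth complex-valued functions with compact support contained in `Ω`. -/
def IsTestFunction (Ω : Set ℂ) (φ : ℂ → ℂ) : Prop :=
  ContDiff ℝ ∞ φ ∧ HasCompactSupport φ ∧ tsupport φ ⊆ Ω

/-- `u'` is the weak derivative of `u` in `Ω` in the direction `v`. -/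
def IsWeakDeriv (Ω : Set ℂ) (v : ℂ) (u u' : ℂ → ℂ) : Prop :=
  ∀ φ : ℂ → ℂ, IsTestFunction Ω φ →
    ∫ z in Ω, u z * fderiv ℝ φ z v = -∫ z in Ω, u' z * φ z

/-- `u ∈ H¹(Ω)` with weak partial derivatives `ux = ∂u/∂x` and `uy = ∂u/∂y`. -/
structure HasH1Gradient (Ω : Set ℂ) (u ux uy : ℂ → ℂ) : Prop where
  memLp : MemLp u 2 (volume.restrict Ω)
  memLp_x : MemLp ux 2 (volume.restrict Ω)
  memLp_y : MemLp uy 2 (volume.restrict Ω)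
  weak_x : IsWeakDeriv Ω 1 u ux
  weak_y : IsWeakDeriv Ω Complex.I u uy

/-- `u ∈ H¹(Ω)`. -/
def MemH1 (Ω : Set ℂ) (u : ℂ → ℂ) : Prop :=
  ∃ ux uy : ℂ → ℂ, HasH1Gradient Ω u ux uy

/-- `w ∈ H¹(B(0,ρ) ∖ D̄)` has zero trace on `∂D` (from outside `D̄`, where `D̄ ⊆ B(0,ρ)`): it is
the `H¹(B(0,ρ) ∖ D̄)`-limit of smooth functions vanishing near `D̄`. -/
def HasZeroTrace (D : Set ℂ) (ρ : ℝ) (w : ℂ → ℂ) : Prop :=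
  ∃ wx wy : ℂ → ℂ, HasH1Gradient (Metric.ball 0 ρ \ closure D) w wx wy ∧
    ∃ φ : ℕ → ℂ → ℂ, (∀ n, IsTestFunction (closure D)ᶜ (φ n)) ∧
      Tendsto (fun n => eLpNorm (fun z => w z - φ n z) 2
        (volume.restrict (Metric.ball 0 ρ \ closure D))) atTop (𝓝 0) ∧
      Tendsto (fun n => eLpNorm (fun z => wx z - fderiv ℝ (φ n) z 1) 2
        (volume.restrict (Metric.ball 0 ρ \ closure D))) atTop (𝓝 0) ∧
      Tendsto (fun n => eLpNorm (fun z => wy z - fderiv ℝ (φ n) z Complex.I) 2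
        (volume.restrict (Metric.ball 0 ρ \ closure D))) atTop (𝓝 0)

/-- The real compression map `T(r) = (R₂ - R₁)(r - R₁)/(R₂ - r)`. -/
noncomputable def T (R₁ R₂ r : ℝ) : ℝ := (R₂ - R₁) * (r - R₁) / (R₂ - r)

/-- The complex compression coordinate `r̃ = S(r)`. -/
noncomputable def S (R₁ R₂ σ₀ σ₁ r : ℝ) : ℂ :=
  if r ≤ R₁ then (r : ℂ)
  else (R₁ : ℂ) + (σ₁ : ℂ) * (T R₁ R₂ r : ℂ) + Complex.I * (σ₀ : ℂ) * (T R₁ R₂ r : ℂ)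

/-- `α = dr̃/dr`. -/
noncomputable def α (R₁ R₂ σ₀ σ₁ r : ℝ) : ℂ := deriv (S R₁ R₂ σ₀ σ₁) r

/-- `β = r̃/r`. -/
noncomputable def β (R₁ R₂ σ₀ σ₁ r : ℝ) : ℂ := S R₁ R₂ σ₀ σ₁ r / (r : ℂ)

/-- Radial derivative `∂u/∂r = cos θ ∂u/∂x + sin θ ∂u/∂y` at `z = r e^{iθ}`, in terms of the
values `a = ∂u/∂x`, `b = ∂u/∂y` at `z`. -/
noncomputable def radial (z a b : ℂ) : ℂ :=
  ((z.re / ‖z‖ : ℝ) : ℂ) * a + ((z.im / ‖z‖ : ℝ) : ℂ) * b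

/-- Angular derivative `(1/r) ∂u/∂θ = -sin θ ∂u/∂x + cos θ ∂u/∂y` at `z = r e^{iθ}`, in terms of
the values `a = ∂u/∂x`, `b = ∂u/∂y` at `z`. -/
noncomputable def angular (z a b : ℂ) : ℂ :=
  -((z.im / ‖z‖ : ℝ) : ℂ) * a + ((z.re / ‖z‖ : ℝ) : ℂ) * b

/-- The PAL equation
`(1/r) ∂_r ((β r/α) ∂_r U) + (1/r²) (α/β) ∂_θ² U + α β k² U = f`
in `B(0,R₂) ∖ D̄`, in weak form: tested with `φ` against the area element `r dr dθ`. Since the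
test functions do not have to vanish on `|z| = R₁`, this contains the usual transmission
conditions there. `Ux`, `Uy` are the weak partial derivatives of `U`. -/
def WeakPALEquation (k R₁ R₂ σ₀ σ₁ : ℝ) (D : Set ℂ) (f U Ux Uy : ℂ → ℂ) : Prop :=
  ∀ φ : ℂ → ℂ, IsTestFunction (Metric.ball 0 R₂ \ closure D) φ →
    ∫ z in Metric.ball 0 R₂ \ closure D,
      (-(β R₁ R₂ σ₀ σ₁ ‖z‖ / α R₁ R₂ σ₀ σ₁ ‖z‖
          * radial z (Ux z) (Uy z) * radial z (fderiv ℝ φ z 1) (fderiv ℝ φ z Complex.I))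
        - α R₁ R₂ σ₀ σ₁ ‖z‖ / β R₁ R₂ σ₀ σ₁ ‖z‖
          * angular z (Ux z) (Uy z) * angular z (fderiv ℝ φ z 1) (fderiv ℝ φ z Complex.I)
        + α R₁ R₂ σ₀ σ₁ ‖z‖ * β R₁ R₂ σ₀ σ₁ ‖z‖ * (k : ℂ) ^ 2 * U z * φ z)
      = ∫ z in Metric.ball 0 R₂ \ closure D, f z * φ z

/-- `U` solves the circular PAL problem with scatterer `D`, source `f` and Dirichlet datum
`g = G|_{∂D}` (elements `g` of `H^{1/2}(∂D)` being the traces of functions `G ∈ H¹(ℝ²)`).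
`U` is `H¹` away from the outer circle `|z| = R₂`. So that `U` has values on circles, it stands for
its continuous representative in the layer `R₁ ≤ |z| < R₂`. -/
structure IsSolution (k R₁ R₂ σ₀ σ₁ : ℝ) (D : Set ℂ) (f G U : ℂ → ℂ) : Prop where
  equation : ∃ Ux Uy : ℂ → ℂ,
    (∀ ρ < R₂, HasH1Gradient (Metric.ball 0 ρ \ closure D) U Ux Uy) ∧
    WeakPALEquation k R₁ R₂ σ₀ σ₁ D f U Ux Uy
  dirichlet : HasZeroTrace D R₁ (fun z => U z - G z)
  bounded : ∃ M : ℝ, ∃ r₀ < R₂, ∀ z : ℂ, r₀ < ‖z‖ → ‖z‖ < R₂ → ‖U z‖ ≤ M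
  continuousOn : ContinuousOn U {z : ℂ | R₁ ≤ ‖z‖ ∧ ‖z‖ < R₂}

/-- The normalized radial variable `τ = (r - R₁)/(R₂ - R₁)`. -/
noncomputable def τ (R₁ R₂ r : ℝ) : ℝ := (r - R₁) / (R₂ - R₁)

/-- `h(τ) = R₁² / ((R₁(1-τ) + σ₁ d τ)² + σ₀² d² τ²)` with `d = R₂ - R₁`. -/
noncomputable def h (R₁ R₂ σ₀ σ₁ t : ℝ) : ℝ :=
  R₁ ^ 2 / ((R₁ * (1 - t) + σ₁ * (R₂ - R₁) * t) ^ 2 + σ₀ ^ 2 * (R₂ - R₁) ^ 2 * t ^ 2)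

/-- `∫₀^{2π} |U(r,θ)|² dθ`. -/
noncomputable def circleEnergy (U : ℂ → ℂ) (r : ℝ) : ℝ :=
  ∫ θ in (0 : ℝ)..(2 * Real.pi), ‖U (circleMap 0 r θ)‖ ^ 2

end PAL

/-! In the layer, each angular mode `u` of the solution satisfies, in the coordinate s = S(r),
Bessel's equation (s u')' + (k² s - n²/s) u = 0. With x = -iks this is the modified equation, and Re
x = k σ₀ T(r) is positive in the open layer and tends to infinity at R₂. The theorem follows from
three facts.

(1) Modes. Testing the weak equation with ψ(r) e^{inθ} and moving the derivatives off `U` gives the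
radial equation in the sense of distributions (`IsSolution.isVeryWeakRadialSolution`).

(2) Uniqueness. A continuous distributional solution bounded near R₂ is a multiple of K_n(-ikS)
(`IsVeryWeakRadialSolution.eq_mul_layerK`). Reduction of order by K_n, which has no zeros in the
right half plane, makes the solution classical. Let v be its difference from the multiple of K_n
that agrees with it at some r₀. With ω = σ₁ + iσ₀ and m = (S/α) v', the flux Φ = Re(i ω̄ m v̄) is
nondecreasing, and boundedness of v gives Φ' ≥ c (log(1+T))' Φ². A positive flux would blow up
before R₂ (`nonpos_of_riccati`), so Φ ≤ 0 near R₂. Since Φ(r₀) = 0, the flux vanishes from r₀ on,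
and so does v.

(3) Decay uniform in n. Nicholson's formula (`integrable_and_norm_sq_besselK`) writes |K_ν(x)|² as a
positive superposition of terms exp(-p e^t - (q + sinh² a) e^{-t}) with p = |x|² and q = (Re
x)²/|x|². When p and q grow by A and B, the inequality A e^t + B e^{-t} ≥ 2√(AB) extracts the factor
exp(-2√(AB)) from every term, whatever ν is (`norm_sq_besselK_le`). Along S both p and q increase,
and starting from R₁ one has AB = (kσ₀T)² (1 - R₁²/|S|²).

The rate does not depend on n, so Parseval's identity sums the modes. Since T = dτ/(1-τ), this is
the stated exponent. Replacing the square root by 1 changes it by a bounded amount only, which gives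
the asymptotic bound. -/

namespace PAL

/-! ### The integrals `∫ exp (ν t - u e^t - v e^{-t}) dt` -/

/-- The integrand `exp (ν t - u e^t - v e^{-t})`. -/
noncomputable def besselIntegrand (ν : ℝ) (u v : ℂ) (t : ℝ) : ℂ :=
  Complex.exp (ν * t - u * (Real.exp t : ℝ) - v * (Real.exp (-t) : ℝ))

/-- The integral of `exp (ν t - u e^t - v e^{-t})` over the real line. -/
noncomputable def besselIntegral (ν : ℝ) (u v : ℂ) : ℂ :=
  ∫ t, besselIntegrand ν u v t

lemma norm_besselIntegrand (ν : ℝ) (u v : ℂ) (t : ℝ) :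
    ‖besselIntegrand ν u v t‖ = Real.exp (ν * t - u.re * Real.exp t - v.re * Real.exp (-t)) := by
  rw [besselIntegrand, Complex.norm_exp]
  congr 1
  simp only [Complex.sub_re, Complex.re_mul_ofReal]
  simp

lemma continuous_besselIntegrand (ν : ℝ) (u v : ℂ) : Continuous (besselIntegrand ν u v) := by
  unfold besselIntegrand
  fun_prop

lemma sq_div_two_le_exp_add_exp_neg (t : ℝ) : t ^ 2 / 2 ≤ Real.exp t + Real.exp (-t) := by
  wlog ht : 0 ≤ t generalizing t
  · have := this (-t) (by linarith)
    rw [neg_neg] at this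
    nlinarith
  have h1 := Real.quadratic_le_exp_of_nonneg ht
  have h2 := Real.exp_pos (-t)
  linarith

/-- Since e^t + e^{-t} ≥ t²/2, the integrand is dominated by a Gaussian times e^{νt}. -/
lemma integrable_exp_sub_exp (ν : ℝ) {a b : ℝ} (ha : 0 < a) (hb : 0 < b) :
    Integrable (fun t : ℝ => Real.exp (ν * t - a * Real.exp t - b * Real.exp (-t))) := by
  set ε := min a b with hε
  have hεpos : 0 < ε := lt_min ha hb
  have hq : Integrable (fun t : ℝ => Complex.exp (-((ε / 2 : ℝ) : ℂ) * (t : ℂ) ^ 2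
      + (ν : ℂ) * t + 0)) := by
    apply integrable_cexp_quadratic
    rw [Complex.ofReal_re]
    positivity
  refine hq.norm.mono' (by fun_prop) (ae_of_all _ fun t => ?_)
  rw [Real.norm_of_nonneg (Real.exp_pos _).le, Complex.norm_exp]
  apply Real.exp_le_exp.2
  have h0 : (-((ε / 2 : ℝ) : ℂ) * (t : ℂ) ^ 2 + (ν : ℂ) * t + 0).re = -(ε / 2) * t ^ 2 + ν * t := by
    norm_cast
    rw [add_zero]
  rw [h0]
  have h1 := sq_div_two_le_exp_add_exp_neg t
  have h2 : ε * Real.exp t ≤ a * Real.exp t :=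
    mul_le_mul_of_nonneg_right (min_le_left _ _) (Real.exp_pos _).le
  have h3 : ε * Real.exp (-t) ≤ b * Real.exp (-t) :=
    mul_le_mul_of_nonneg_right (min_le_right _ _) (Real.exp_pos _).le
  have h4 := mul_le_mul_of_nonneg_left h1 hεpos.le
  linarith

lemma integrable_besselIntegrand (ν : ℝ) {u v : ℂ} (hu : 0 < u.re) (hv : 0 < v.re) :
    Integrable (besselIntegrand ν u v) := by
  refine (integrable_exp_sub_exp ν hu hv).mono'
    (continuous_besselIntegrand ν u v).aestronglyMeasurable (ae_of_all _ fun t => ?_)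
  rw [norm_besselIntegrand]

lemma besselIntegrand_mul_exp (ν : ℝ) (u v : ℂ) (t : ℝ) :
    besselIntegrand ν u v t * (Real.exp t : ℝ) = besselIntegrand (ν + 1) u v t := by
  rw [besselIntegrand, besselIntegrand, Complex.ofReal_exp, ← Complex.exp_add]
  congr 1
  push_cast
  ring

lemma besselIntegrand_mul_exp_neg (ν : ℝ) (u v : ℂ) (t : ℝ) :
    besselIntegrand ν u v t * (Real.exp (-t) : ℝ) = besselIntegrand (ν - 1) u v t := by
  rw [besselIntegrand, besselIntegrand, Complex.ofReal_exp (-t), ← Complex.exp_add]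
  congr 1
  push_cast
  ring

/-- Differentiation under the integral sign: the factors e^t and e^{-t} that come down shift the
order by ±1. Two moving parameters are allowed so that the lemma serves both for U = V = x/2 and for
the deformation at fixed product UV. -/
lemma hasDerivAt_besselIntegral {U V U' V' : ℂ → ℂ} (ν : ℝ) (z : ℂ)
    (hU : ∀ z, HasDerivAt U (U' z) z) (hV : ∀ z, HasDerivAt V (V' z) z)
    (hU' : Continuous U') (hV' : Continuous V') (hu : 0 < (U z).re) (hv : 0 < (V z).re) :
    HasDerivAt (fun z => besselIntegral ν (U z) (V z))
      (-U' z * besselIntegral (ν + 1) (U z) (V z) - V' z * besselIntegral (ν - 1) (U z) (V z)) z := by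
  obtain ⟨a, ha, hau⟩ := exists_between hu
  obtain ⟨b, hb, hbv⟩ := exists_between hv
  have cU : Continuous U := continuous_iff_continuousAt.2 fun z => (hU z).continuousAt
  have cV : Continuous V := continuous_iff_continuousAt.2 fun z => (hV z).continuousAt
  set C := max ‖U' z‖ ‖V' z‖ + 1 with hC
  have hCU : ‖U' z‖ < C := lt_of_le_of_lt (le_max_left _ _) (lt_add_one _)
  have hCV : ‖V' z‖ < C := lt_of_le_of_lt (le_max_right _ _) (lt_add_one _)
  set s : Set ℂ := {w | a < (U w).re ∧ b < (V w).re ∧ ‖U' w‖ < C ∧ ‖V' w‖ < C} with hs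
  have hsn : s ∈ 𝓝 z := by
    have hso : IsOpen s := by
      refine .and (isOpen_lt ?_ ?_) (.and (isOpen_lt ?_ ?_)
        (.and (isOpen_lt ?_ ?_) (isOpen_lt ?_ ?_)))
      all_goals fun_prop
    exact hso.mem_nhds ⟨hau, hbv, hCU, hCV⟩
  set bd : ℝ → ℝ := fun t =>
    C * Real.exp ((ν + 1) * t - a * Real.exp t - b * Real.exp (-t))
      + C * Real.exp ((ν - 1) * t - a * Real.exp t - b * Real.exp (-t)) with hbd
  have key := hasDerivAt_integral_of_dominated_loc_of_deriv_le (μ := volume) (x₀ := z) (s := s)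
    (F := fun w t => besselIntegrand ν (U w) (V w) t)
    (F' := fun w t => -U' w * besselIntegrand (ν + 1) (U w) (V w) t
      - V' w * besselIntegrand (ν - 1) (U w) (V w) t) (bound := bd) hsn
    (Eventually.of_forall fun w => (continuous_besselIntegrand ν _ _).aestronglyMeasurable)
    (integrable_besselIntegrand ν hu hv)
    (by
      have h1 := continuous_besselIntegrand (ν + 1) (U z) (V z)
      have h2 := continuous_besselIntegrand (ν - 1) (U z) (V z)
      exact (by fun_prop : Continuous _).aestronglyMeasurable)
    (ae_of_all _ fun t w hw => ?_)
    (((integrable_exp_sub_exp (ν + 1) ha hb).const_mul C).add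
      ((integrable_exp_sub_exp (ν - 1) ha hb).const_mul C))
    (ae_of_all _ fun t w hw => ?_)
  · refine key.2.congr_deriv ?_
    rw [integral_sub, integral_const_mul, integral_const_mul]
    · rfl
    · exact (integrable_besselIntegrand _ hu hv).const_mul _
    · exact (integrable_besselIntegrand _ hu hv).const_mul _
  · obtain ⟨h1, h2, h3, h4⟩ := hw
    have e1 : ∀ μ : ℝ, ‖besselIntegrand μ (U w) (V w) t‖
        ≤ Real.exp (μ * t - a * Real.exp t - b * Real.exp (-t)) := fun μ => by
      rw [norm_besselIntegrand]
      apply Real.exp_le_exp.2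
      have := mul_le_mul_of_nonneg_right h1.le (Real.exp_pos t).le
      have := mul_le_mul_of_nonneg_right h2.le (Real.exp_pos (-t)).le
      linarith
    refine (norm_sub_le _ _).trans (add_le_add ?_ ?_)
    · rw [norm_mul, norm_neg]
      exact mul_le_mul h3.le (e1 _) (norm_nonneg _) ((norm_nonneg _).trans h3.le)
    · rw [norm_mul]
      exact mul_le_mul h4.le (e1 _) (norm_nonneg _) ((norm_nonneg _).trans h4.le)
  · rw [← besselIntegrand_mul_exp, ← besselIntegrand_mul_exp_neg]
    unfold besselIntegrand
    have h1 := ((hU w).mul_const ((Real.exp t : ℝ) : ℂ)).const_sub ((ν : ℂ) * t)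
    have h2 := (h1.fun_sub ((hV w).mul_const ((Real.exp (-t) : ℝ) : ℂ))).cexp
    exact h2.congr_deriv (by ring)

/-- The integrand and its t-derivative are integrable, so the integral of the derivative is zero. -/
lemma besselIntegral_recurrence (ν : ℝ) {u v : ℂ} (hu : 0 < u.re) (hv : 0 < v.re) :
    ν * besselIntegral ν u v = u * besselIntegral (ν + 1) u v - v * besselIntegral (ν - 1) u v := by
  have hd : ∀ t : ℝ, HasDerivAt (besselIntegrand ν u v)
      (ν * besselIntegrand ν u v t - u * besselIntegrand (ν + 1) u v t
        + v * besselIntegrand (ν - 1) u v t) t := fun t => by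
    rw [← besselIntegrand_mul_exp, ← besselIntegrand_mul_exp_neg]
    have e1 : HasDerivAt (fun t : ℝ => ((Real.exp t : ℝ) : ℂ)) ((Real.exp t : ℝ) : ℂ) t :=
      (Real.hasDerivAt_exp t).ofReal_comp
    have e2 : HasDerivAt (fun t : ℝ => ((Real.exp (-t) : ℝ) : ℂ))
        ((Real.exp (-t) * (-1) : ℝ) : ℂ) t :=
      ((hasDerivAt_neg t).exp).ofReal_comp
    have e3 : HasDerivAt (fun t : ℝ => (t : ℂ)) ((1 : ℝ) : ℂ) t := (hasDerivAt_id t).ofReal_comp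
    have h2 := (((e3.const_mul (ν : ℂ)).fun_sub (e1.const_mul u)).fun_sub (e2.const_mul v)).cexp
    unfold besselIntegrand
    refine h2.congr_deriv ?_
    push_cast
    ring
  have i0 := (integrable_besselIntegrand ν hu hv).const_mul (ν : ℂ)
  have i1 := (integrable_besselIntegrand (ν + 1) hu hv).const_mul u
  have i2 := (integrable_besselIntegrand (ν - 1) hu hv).const_mul v
  have := integral_eq_zero_of_hasDerivAt_of_integrable hd ((i0.sub i1).add i2)
    (integrable_besselIntegrand ν hu hv)
  rw [integral_add (i0.sub' i1) i2, integral_sub i0 i1, integral_const_mul, integral_const_mul,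
    integral_const_mul] at this
  change ν * besselIntegral ν u v - u * besselIntegral (ν + 1) u v
    + v * besselIntegral (ν - 1) u v = 0 at this
  linear_combination this

/-! ### The modified Bessel function of the second kind -/

/-- Twice the modified Bessel function `K_ν(x)`, for `0 < re x`. -/
noncomputable def besselK (ν : ℝ) (x : ℂ) : ℂ := besselIntegral ν (x / 2) (x / 2)

/-- The derivative of `besselK`. -/
noncomputable def besselK' (ν : ℝ) (x : ℂ) : ℂ := -(besselK (ν + 1) x + besselK (ν - 1) x) / 2

lemma re_half_pos {x : ℂ} (hx : 0 < x.re) : 0 < (x / 2).re := by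
  rw [Complex.div_ofNat_re]
  positivity

lemma hasDerivAt_besselK (ν : ℝ) {x : ℂ} (hx : 0 < x.re) :
    HasDerivAt (besselK ν) (besselK' ν x) x := by
  have hd : ∀ z : ℂ, HasDerivAt (fun z : ℂ => z / 2) (1 / 2) z := fun z =>
    (hasDerivAt_id z).div_const 2
  refine (hasDerivAt_besselIntegral (U := fun z => z / 2) (V := fun z => z / 2)
    (U' := fun _ => 1 / 2) (V' := fun _ => 1 / 2) ν x hd hd (by fun_prop) (by fun_prop)
    (re_half_pos hx) (re_half_pos hx)).congr_deriv ?_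
  simp only [besselK', besselK]
  ring

lemma besselK_recurrence (ν : ℝ) {x : ℂ} (hx : 0 < x.re) :
    ν * besselK ν x = x / 2 * (besselK (ν + 1) x - besselK (ν - 1) x) := by
  have := besselIntegral_recurrence ν (re_half_pos hx) (re_half_pos hx)
  simp only [besselK]
  linear_combination this

/-- Bessel's modified equation in the form `(x K')' = (x + ν² / x) K`. -/
lemma hasDerivAt_mul_besselK' (ν : ℝ) {x : ℂ} (hx : 0 < x.re) :
    HasDerivAt (fun x => x * besselK' ν x) ((x + ν ^ 2 / x) * besselK ν x) x := by
  have hx0 : x ≠ 0 := fun h => by simp [h] at hx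
  have h1 : HasDerivAt (besselK' ν) (-(besselK' (ν + 1) x + besselK' (ν - 1) x) / 2) x :=
    ((hasDerivAt_besselK (ν + 1) hx).add (hasDerivAt_besselK (ν - 1) hx)).neg.div_const 2
  refine ((hasDerivAt_id' x).fun_mul h1).congr_deriv ?_
  -- The second derivative involves the orders ν and ν ± 2; the recurrences at ν and ν ± 1 bring
  -- everything back to order ν.
  have r0 := besselK_recurrence ν hx
  have r1 := besselK_recurrence (ν + 1) hx
  have r2 := besselK_recurrence (ν - 1) hx
  simp only [besselK', add_sub_cancel_right, sub_add_cancel] at *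
  push_cast at r1 r2
  field_simp
  linear_combination -4 * (ν : ℂ) * r0 - 2 * x * r1 + 2 * x * r2

/-- The modulus of the integrand decreases in Re x, so one bound serves a whole half plane. This
keeps K_ν bounded up to the outer boundary of the layer. -/
lemma norm_besselK_le (ν : ℝ) {x : ℂ} {a : ℝ} (ha : 0 < a) (hx : a ≤ x.re) :
    ‖besselK ν x‖ ≤ ∫ t, Real.exp (ν * t - a / 2 * Real.exp t - a / 2 * Real.exp (-t)) := by
  refine norm_integral_le_of_norm_le (integrable_exp_sub_exp ν (half_pos ha) (half_pos ha))
    (ae_of_all _ fun t => ?_)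
  rw [norm_besselIntegrand, Complex.div_ofNat_re]
  apply Real.exp_le_exp.2
  have := mul_le_mul_of_nonneg_right hx (Real.exp_pos t).le
  have := mul_le_mul_of_nonneg_right hx (Real.exp_pos (-t)).le
  simp only [OfNat.ofNat]
  push_cast
  linarith

/-- `∫ exp (-p e^t - m e^{-t}) dt`, that is `2 K₀(2 √(p m))`. -/
noncomputable def besselZero (p m : ℝ) : ℝ := ∫ t, Real.exp (-p * Real.exp t - m * Real.exp (-t))

lemma integrable_besselZero {p m : ℝ} (hp : 0 < p) (hm : 0 < m) :
    Integrable (fun t => Real.exp (-p * Real.exp t - m * Real.exp (-t))) := by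
  convert integrable_exp_sub_exp 0 hp hm using 3
  ring

lemma besselZero_pos {p m : ℝ} (hp : 0 < p) (hm : 0 < m) : 0 < besselZero p m :=
  integral_exp_pos (integrable_besselZero hp hm)

lemma besselIntegral_zero_ofReal (p m : ℝ) : besselIntegral 0 p m = besselZero p m := by
  rw [besselZero, besselIntegral, ← integral_complex_ofReal]
  refine integral_congr_ae (ae_of_all _ fun t => ?_)
  simp only [besselIntegrand]
  push_cast
  congr 1
  ring

lemma re_exp_pos_of_abs_im_lt {z : ℂ} (hz : |z.im| < Real.pi / 2) : 0 < (Complex.exp z).re := by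
  rw [Complex.exp_re]
  rw [abs_lt] at hz
  exact mul_pos (Real.exp_pos _) (Real.cos_pos_of_mem_Ioo hz)

/-- `besselIntegral 0 u v` depends only on the product `u v`. -/
lemma besselIntegral_zero_conj {u : ℂ} {p m : ℝ} (hu : 0 < u.re) (hp : 0 < p) (hm : 0 < m)
    (h : ‖u‖ ^ 2 = p * m) : besselIntegral 0 u (starRingEnd ℂ u) = besselZero p m := by
  have hu0 : u ≠ 0 := fun h => by simp [h] at hu
  have harg : |u.arg| < Real.pi / 2 := by
    rw [Complex.abs_arg_lt_pi_div_two_iff]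
    exact Or.inl hu
  -- Deformation in place of a contour shift: U(z) = u^{1-z} p^z and V(z) = ū^{1-z} m^z have
  -- constant product and join (u, ū) to (p, m). On [0, 1] the arguments are only scaled by 1 - s,
  -- so both stay in the right half plane. The derivative along the path is -c times the right side
  -- of the recurrence at order 0, hence zero.
  set c : ℂ := (Real.log p : ℂ) - Complex.log u with hc
  have hc' : (Real.log m : ℂ) - starRingEnd ℂ (Complex.log u) = -c := by
    have h1 : (Real.log p : ℂ) + Real.log m = 2 * (Real.log ‖u‖ : ℂ) := by
      have : Real.log p + Real.log m = 2 * Real.log ‖u‖ := by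
        rw [← Real.log_mul hp.ne' hm.ne', ← h, Real.log_pow]
        norm_num
      exact_mod_cast this
    have h2 : Complex.log u + starRingEnd ℂ (Complex.log u) = 2 * (Real.log ‖u‖ : ℂ) := by
      rw [Complex.add_conj, Complex.log_re]
      push_cast
      ring
    rw [hc]
    linear_combination h1 - h2
  set U : ℂ → ℂ := fun z => Complex.exp (Complex.log u + z * c) with hU
  set V : ℂ → ℂ := fun z => Complex.exp (starRingEnd ℂ (Complex.log u) + z * (-c)) with hV
  have dU : ∀ z, HasDerivAt U (U z * c) z := fun z => by
    have := (((hasDerivAt_id' z).mul_const c).const_add (Complex.log u)).cexp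
    simpa [hU] using this
  have dV : ∀ z, HasDerivAt V (V z * (-c)) z := fun z => by
    have := (((hasDerivAt_id' z).mul_const (-c)).const_add (starRingEnd ℂ (Complex.log u))).cexp
    simpa [hV] using this
  have cim : c.im = -u.arg := by
    rw [hc, Complex.sub_im, Complex.ofReal_im, Complex.log_im]
    ring
  have bd : ∀ s ∈ Icc (0 : ℝ) 1, |(1 - s) * u.arg| < Real.pi / 2 := fun s hs => by
    rw [abs_mul, abs_of_nonneg (by linarith [hs.2])]
    have : (1 - s) * |u.arg| ≤ 1 * |u.arg| :=
      mul_le_mul_of_nonneg_right (by linarith [hs.1]) (abs_nonneg _)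
    linarith
  have reU : ∀ s ∈ Icc (0 : ℝ) 1, 0 < (U s).re := fun s hs => by
    apply re_exp_pos_of_abs_im_lt
    have : (Complex.log u + s * c).im = (1 - s) * u.arg := by
      rw [Complex.add_im, Complex.log_im, Complex.im_ofReal_mul, cim]
      ring
    rw [this]
    exact bd s hs
  have reV : ∀ s ∈ Icc (0 : ℝ) 1, 0 < (V s).re := fun s hs => by
    apply re_exp_pos_of_abs_im_lt
    have : (starRingEnd ℂ (Complex.log u) + s * (-c)).im = -((1 - s) * u.arg) := by
      rw [Complex.add_im, Complex.conj_im, Complex.log_im, Complex.im_ofReal_mul, Complex.neg_im,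
        cim]
      ring
    rw [this, abs_neg]
    exact bd s hs
  have der : ∀ s ∈ Icc (0 : ℝ) 1,
      HasDerivAt (fun s : ℝ => besselIntegral 0 (U s) (V s)) 0 s := fun s hs => by
    have h1 := hasDerivAt_besselIntegral 0 (s : ℂ) dU dV
      (by rw [hU]; fun_prop) (by rw [hV]; fun_prop) (reU s hs) (reV s hs)
    have h2 := besselIntegral_recurrence 0 (reU s hs) (reV s hs)
    refine h1.comp_ofReal.congr_deriv ?_
    push_cast at h2
    linear_combination c * h2
  have hconst := constant_of_has_deriv_right_zero
    (fun s hs => (der s hs).continuousAt.continuousWithinAt)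
    (fun s hs => (der s (Ico_subset_Icc_self hs)).hasDerivWithinAt) 1 (by simp)
  have U0 : U (0 : ℝ) = u := by simp [hU, Complex.exp_log hu0]
  have V0 : V (0 : ℝ) = starRingEnd ℂ u := by
    simp only [hV, Complex.ofReal_zero, zero_mul, add_zero, Complex.exp_conj, Complex.exp_log hu0]
  have U1 : U (1 : ℝ) = p := by
    simp only [hU, hc, Complex.ofReal_one, one_mul, add_sub_cancel, ← Complex.ofReal_exp,
      Real.exp_log hp]
  have V1 : V (1 : ℝ) = m := by
    simp only [hV, ← hc', Complex.ofReal_one, one_mul, add_sub_cancel, ← Complex.ofReal_exp,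
      Real.exp_log hm]
  simp only [U0, V0, U1, V1] at hconst
  rw [← hconst, besselIntegral_zero_ofReal]

/-- Nicholson's formula for `‖K_ν(x)‖²`. -/
lemma integrable_and_norm_sq_besselK (ν : ℝ) {x : ℂ} (hx : 0 < x.re) {p q : ℝ}
    (hp : p = ‖x‖ ^ 2) (hq : p * q = x.re ^ 2) :
    Integrable (fun a => Real.exp (2 * ν * a) * besselZero p (q + Real.sinh a ^ 2)) ∧
    ‖besselK ν x‖ ^ 2 = 2 * ∫ a, Real.exp (2 * ν * a) * besselZero p (q + Real.sinh a ^ 2) := by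
  have hx0 : x ≠ 0 := fun h => by simp [h] at hx
  have hp0 : 0 < p := by rw [hp]; positivity
  have hq0 : 0 < q := by
    have : 0 < p * q := by rw [hq]; positivity
    exact (pos_iff_pos_of_mul_pos this).1 hp0
  set f := besselIntegrand ν (x / 2) (x / 2) with hf
  set g := fun t => starRingEnd ℂ (f t) with hg
  have fi : Integrable f := integrable_besselIntegrand ν (re_half_pos hx) (re_half_pos hx)
  have fc : Continuous f := continuous_besselIntegrand _ _ _
  have gc : Continuous g := Complex.continuous_conj.comp fc
  have gn : ∀ t, ‖g t‖ = ‖f t‖ := fun t => by simp [hg]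
  have gi : Integrable g := by
    refine fi.norm.mono' gc.aestronglyMeasurable (ae_of_all _ fun t => ?_)
    rw [gn]
  have shift : ∀ (F : ℝ → ℂ) (t : ℝ), ∫ a, F (2 * a - t) = 2⁻¹ * ∫ a, F a := fun F t => by
    rw [Measure.integral_comp_mul_left (fun a => F (a - t)) 2, integral_sub_right_eq_self F]
    norm_num
  have shiftR : ∀ (F : ℝ → ℝ) (t : ℝ), ∫ a, F (2 * a - t) = 2⁻¹ * ∫ a, F a := fun F t => by
    rw [Measure.integral_comp_mul_left (fun a => F (a - t)) 2, integral_sub_right_eq_self F]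
    norm_num
  -- K_ν times its conjugate is the double integral of f(t) g(s). The substitution s = 2a - t has
  -- Jacobian 2, which is the constant in the formula.
  have Wi : Integrable (Function.uncurry fun a t => f t * g (2 * a - t))
      ((volume : Measure ℝ).prod volume) := by
    rw [integrable_prod_iff' (by
      have : Continuous (Function.uncurry fun a t => f t * g (2 * a - t)) := by
        unfold Function.uncurry
        fun_prop
      exact this.aestronglyMeasurable)]
    refine ⟨ae_of_all _ fun t => ?_, ?_⟩
    · exact (((gi.comp_sub_right t).comp_mul_left' (two_ne_zero)).const_mul (f t))
    · simp only [Function.uncurry, norm_mul]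
      simp_rw [integral_const_mul, shiftR (fun a => ‖g a‖)]
      exact fi.norm.mul_const _
  have inner : ∀ a : ℝ, ∫ t, f t * g (2 * a - t)
      = ((Real.exp (2 * ν * a) * besselZero p (q + Real.sinh a ^ 2) : ℝ) : ℂ) := fun a => by
    -- With t = a + b the product f(a+b) g(a-b) is exp(2νa - u e^b - ū e^{-b}), an integrand of
    -- order 0 in b. Here |u|² = (Re x)² cosh² a + (Im x)² sinh² a = p (q + sinh² a), so u and ū may
    -- be replaced by the real pair p, q + sinh² a.
    set u : ℂ := (x * (Real.exp a : ℝ) + starRingEnd ℂ x * (Real.exp (-a) : ℝ)) / 2 with hu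
    have ure : u.re = x.re * Real.cosh a := by
      rw [hu, Complex.div_ofNat_re, Complex.add_re, Complex.re_mul_ofReal, Complex.re_mul_ofReal,
        Complex.conj_re, Real.cosh_eq]
      ring
    have uim : u.im = x.im * Real.sinh a := by
      rw [hu, Complex.div_ofNat_im, Complex.add_im, Complex.im_mul_ofReal, Complex.im_mul_ofReal,
        Complex.conj_im, Real.sinh_eq]
      ring
    have hn : ‖u‖ ^ 2 = p * (q + Real.sinh a ^ 2) := by
      have h1 : p * (q + Real.sinh a ^ 2) = x.re ^ 2 + p * Real.sinh a ^ 2 := by rw [← hq]; ring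
      rw [h1, hp, Complex.sq_norm, Complex.sq_norm, Complex.normSq_apply, Complex.normSq_apply, ure,
        uim]
      linear_combination x.re ^ 2 * Real.cosh_sq a
    have hpos : 0 < u.re := by rw [ure]; exact mul_pos hx (Real.cosh_pos a)
    rw [Complex.ofReal_mul, ← besselIntegral_zero_conj hpos hp0 (by positivity) hn, besselIntegral,
      ← integral_const_mul, ← integral_add_left_eq_self _ a]
    refine integral_congr_ae (ae_of_all _ fun b => ?_)
    simp only [hg, hf, besselIntegrand, ← Complex.exp_conj, Complex.ofReal_exp, ← Complex.exp_add]
    congr 1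
    simp only [hu, map_sub, map_mul, map_add, map_div₀, Complex.conj_ofReal, Complex.conj_conj,
      ← Complex.exp_conj, map_ofNat]
    push_cast
    have e1 : Complex.exp (2 * (a : ℂ) - (a + b)) = Complex.exp a * Complex.exp (-b) := by
      rw [← Complex.exp_add]; congr 1; ring
    have e2 : Complex.exp (-(2 * (a : ℂ) - (a + b))) = Complex.exp (-a) * Complex.exp b := by
      rw [← Complex.exp_add]; congr 1; ring
    have e3 : Complex.exp (-((a : ℂ) + b)) = Complex.exp (-a) * Complex.exp (-b) := by
      rw [← Complex.exp_add]; congr 1; ring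
    rw [e1, e2, e3, Complex.exp_add]
    ring
  constructor
  · have h1 := Wi.integral_prod_left
    simp only [Function.uncurry, inner] at h1
    exact h1.re
  · have h1 := integral_integral_swap Wi
    simp_rw [inner, integral_const_mul, shift, integral_mul_const] at h1
    rw [integral_complex_ofReal] at h1
    have h2 : ∫ a, g a = starRingEnd ℂ (∫ a, f a) := integral_conj
    have h3 : ∫ a, f a = besselK ν x := rfl
    rw [h2, h3] at h1
    have h4 : besselK ν x * starRingEnd ℂ (besselK ν x) = ((‖besselK ν x‖ ^ 2 : ℝ) : ℂ) := by
      rw [Complex.mul_conj, Complex.sq_norm]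
    have h5 : ((‖besselK ν x‖ ^ 2 : ℝ) : ℂ)
        = ((2 * ∫ a, Real.exp (2 * ν * a) * besselZero p (q + Real.sinh a ^ 2) : ℝ) : ℂ) := by
      rw [Complex.ofReal_mul, h1, ← h4]
      push_cast
      ring
    exact_mod_cast h5

/-- The integrand in Nicholson's formula is strictly positive. Absence of zeros is what permits
reduction of order by K_ν. -/
lemma besselK_ne_zero (ν : ℝ) {x : ℂ} (hx : 0 < x.re) : besselK ν x ≠ 0 := by
  have hx0 : x ≠ 0 := fun h => by simp [h] at hx
  have hp0 : 0 < ‖x‖ ^ 2 := by positivity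
  have hq0 : 0 < x.re ^ 2 / ‖x‖ ^ 2 := by positivity
  obtain ⟨hi, he⟩ := integrable_and_norm_sq_besselK ν hx (p := ‖x‖ ^ 2)
    (q := x.re ^ 2 / ‖x‖ ^ 2) rfl (by field_simp)
  have hpos : ∀ a, 0 < Real.exp (2 * ν * a)
      * besselZero (‖x‖ ^ 2) (x.re ^ 2 / ‖x‖ ^ 2 + Real.sinh a ^ 2) := fun a =>
    mul_pos (Real.exp_pos _) (besselZero_pos hp0 (by positivity))
  intro h0
  rw [h0, norm_zero] at he
  have h1 := (integral_pos_iff_support_of_nonneg (fun a => (hpos a).le) hi).2 (by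
    rw [Function.support_eq_univ fun a => (hpos a).ne']
    simp)
  simp only [ne_eq, OfNat.ofNat_ne_zero, not_false_eq_true, zero_pow] at he
  linarith

/-- The uniform decay of `K_ν` in the right half plane, in terms of `p = ‖x‖²` and
`q = (re x)² / ‖x‖²`. -/
lemma norm_sq_besselK_le (ν : ℝ) {x x₀ : ℂ} (hx : 0 < x.re) (hx₀ : 0 < x₀.re) {p q p₀ q₀ : ℝ}
    (hp : p = ‖x‖ ^ 2) (hq : p * q = x.re ^ 2) (hp₀ : p₀ = ‖x₀‖ ^ 2) (hq₀ : p₀ * q₀ = x₀.re ^ 2)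
    (hpp : p₀ ≤ p) (hqq : q₀ ≤ q) :
    ‖besselK ν x‖ ^ 2
      ≤ Real.exp (-(2 * Real.sqrt ((p - p₀) * (q - q₀)))) * ‖besselK ν x₀‖ ^ 2 := by
  obtain ⟨hi, he⟩ := integrable_and_norm_sq_besselK ν hx hp hq
  obtain ⟨hi₀, he₀⟩ := integrable_and_norm_sq_besselK ν hx₀ hp₀ hq₀
  have hx0 : x₀ ≠ 0 := fun h => by simp [h] at hx₀
  have hpp0 : 0 < p₀ := by rw [hp₀]; positivity
  have hqq0 : 0 < q₀ := by
    have : 0 < p₀ * q₀ := by rw [hq₀]; positivity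
    exact (pos_iff_pos_of_mul_pos this).1 hpp0
  set A := p - p₀ with hA
  set B := q - q₀ with hB
  have hA0 : 0 ≤ A := sub_nonneg.2 hpp
  have hB0 : 0 ≤ B := sub_nonneg.2 hqq
  -- Pointwise in t, A e^t + B e^{-t} ≥ 2√(AB). The bound is later applied with s = sinh² a and does
  -- not see ν.
  have hZ : ∀ s : ℝ, 0 ≤ s → besselZero p (q + s)
      ≤ Real.exp (-(2 * Real.sqrt (A * B))) * besselZero p₀ (q₀ + s) := fun s hs => by
    rw [besselZero, besselZero, ← integral_const_mul]
    refine integral_mono (integrable_besselZero (hpp0.trans_le hpp) (by linarith))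
      ((integrable_besselZero hpp0 (by linarith)).const_mul _) fun t => ?_
    simp only
    rw [← Real.exp_add]
    apply Real.exp_le_exp.2
    have h1 : Real.sqrt (A * B) = Real.sqrt (A * Real.exp t) * Real.sqrt (B * Real.exp (-t)) := by
      rw [← Real.sqrt_mul (by positivity)]
      congr 1
      have : Real.exp t * Real.exp (-t) = 1 := by rw [← Real.exp_add]; simp
      linear_combination -(A * B) * this
    have h2 := sq_nonneg (Real.sqrt (A * Real.exp t) - Real.sqrt (B * Real.exp (-t)))
    have h3 := Real.sq_sqrt (by positivity : 0 ≤ A * Real.exp t)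
    have h4 := Real.sq_sqrt (by positivity : 0 ≤ B * Real.exp (-t))
    have h5 : p = p₀ + A := by rw [hA]; ring
    have h6 : q = q₀ + B := by rw [hB]; ring
    rw [h1, h5, h6]
    nlinarith
  rw [he, he₀, ← mul_assoc, mul_comm (Real.exp _) 2, mul_assoc]
  refine mul_le_mul_of_nonneg_left ?_ zero_le_two
  rw [← integral_const_mul]
  refine integral_mono hi (hi₀.const_mul _) fun a => ?_
  have := mul_le_mul_of_nonneg_left (hZ _ (sq_nonneg (Real.sinh a))) (Real.exp_pos (2 * ν * a)).le
  simp only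
  linarith

/-! ### Test functions -/

/-- Smooth complex-valued functions with compact support contained in `Ω`. -/
structure IsTest {E : Type*} [NormedAddCommGroup E] [NormedSpace ℝ E] (Ω : Set E) (φ : E → ℂ) :
    Prop where
  contDiff : ContDiff ℝ ∞ φ
  compact : HasCompactSupport φ
  subset : tsupport φ ⊆ Ω

section Test
variable {E : Type*} [NormedAddCommGroup E] [NormedSpace ℝ E] {Ω : Set E} {φ ψ : E → ℂ}

lemma IsTest.add (hφ : IsTest Ω φ) (hψ : IsTest Ω ψ) : IsTest Ω (fun x => φ x + ψ x) :=
  ⟨hφ.contDiff.add hψ.contDiff, hφ.compact.add hψ.compact,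
    (tsupport_add φ ψ).trans (union_subset hφ.subset hψ.subset)⟩

lemma IsTest.const_mul (c : ℂ) (hφ : IsTest Ω φ) : IsTest Ω (fun x => c * φ x) :=
  ⟨contDiff_const.mul hφ.contDiff, hφ.compact.mul_left,
    (tsupport_mul_subset_right (f := fun _ => c) (g := φ)).trans hφ.subset⟩

lemma IsTest.sub (hφ : IsTest Ω φ) (hψ : IsTest Ω ψ) : IsTest Ω (fun x => φ x - ψ x) := by
  convert hφ.add (hψ.const_mul (-1)) using 2
  ring

lemma IsTest.apply_eq_zero (hφ : IsTest Ω φ) {x : E} (hx : x ∉ Ω) : φ x = 0 :=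
  image_eq_zero_of_notMem_tsupport fun h => hx (hφ.subset h)

lemma contDiff_of_contDiffAt_tsupport (h : ∀ x ∈ tsupport φ, ContDiffAt ℝ ∞ φ x) :
    ContDiff ℝ ∞ φ := by
  rw [contDiff_iff_contDiffAt]
  intro x
  by_cases hx : x ∈ tsupport φ
  · exact h x hx
  · exact (contDiffAt_const (c := (0 : ℂ))).congr_of_eventuallyEq
      (notMem_tsupport_iff_eventuallyEq.1 hx)

lemma IsTest.mul (hφ : IsTest Ω φ) (hΩ : IsOpen Ω) {g : E → ℂ} (hg : ContDiffOn ℝ ∞ g Ω) :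
    IsTest Ω (fun x => g x * φ x) := by
  have hsub : tsupport (fun x => g x * φ x) ⊆ tsupport φ := tsupport_mul_subset_right
  refine ⟨contDiff_of_contDiffAt_tsupport fun x hx => ?_, hφ.compact.mul_left,
    hsub.trans hφ.subset⟩
  exact (hg.contDiffAt (hΩ.mem_nhds (hφ.subset (hsub hx)))).mul hφ.contDiff.contDiffAt

lemma IsTest.continuous_mul (hφ : IsTest Ω φ) (hΩ : IsOpen Ω) {g : E → ℂ}
    (hg : ContinuousOn g Ω) : Continuous (fun x => g x * φ x) := by
  refine continuous_of_tsupport fun x hx => ?_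
  have hx' := hφ.subset (tsupport_mul_subset_right (f := g) hx)
  exact (hg.continuousAt (hΩ.mem_nhds hx')).mul hφ.contDiff.continuous.continuousAt

lemma IsTest.integrable_mul [MeasurableSpace E] [BorelSpace E] [FiniteDimensional ℝ E]
    {μ : Measure E} [IsFiniteMeasureOnCompacts μ]
    (hφ : IsTest Ω φ) (hΩ : IsOpen Ω) {g : E → ℂ} (hg : ContinuousOn g Ω) :
    Integrable (fun x => g x * φ x) μ :=
  (hφ.continuous_mul hΩ hg).integrable_of_hasCompactSupport hφ.compact.mul_left

lemma IsTest.integrable [MeasurableSpace E] [BorelSpace E] [FiniteDimensional ℝ E]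
    {μ : Measure E} [IsFiniteMeasureOnCompacts μ] (hφ : IsTest Ω φ) : Integrable φ μ :=
  hφ.contDiff.continuous.integrable_of_hasCompactSupport hφ.compact

lemma IsTest.fderiv_apply (hφ : IsTest Ω φ) (v : E) : IsTest Ω (fun x => fderiv ℝ φ x v) :=
  ⟨(hφ.contDiff.fderiv_right (m := ∞) (by simp)).clm_apply contDiff_const,
    hφ.compact.fderiv_apply (𝕜 := ℝ) v,
    (tsupport_fderiv_apply_subset ℝ v).trans hφ.subset⟩

end Test

lemma IsTest.deriv {Ω : Set ℝ} {φ : ℝ → ℂ} (hφ : IsTest Ω φ) : IsTest Ω (deriv φ) :=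
  ⟨(contDiff_infty_iff_deriv.1 hφ.contDiff).2, hφ.compact.deriv,
    tsupport_deriv_subset.trans hφ.subset⟩

lemma IsTest.hasDerivAt {Ω : Set ℝ} {φ : ℝ → ℂ} (hφ : IsTest Ω φ) (x : ℝ) :
    HasDerivAt φ (_root_.deriv φ x) x :=
  ((contDiff_infty_iff_deriv.1 hφ.contDiff).1 x).hasDerivAt

lemma IsTest.integral_deriv {Ω : Set ℝ} {φ : ℝ → ℂ} (hφ : IsTest Ω φ) :
    ∫ x, _root_.deriv φ x = 0 :=
  integral_eq_zero_of_hasDerivAt_of_integrable hφ.hasDerivAt hφ.deriv.integrable hφ.integrable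

lemma exists_Icc_of_isCompact_subset_Ioo {a b : ℝ} (hab : a < b) {K : Set ℝ} (hK : IsCompact K)
    (h : K ⊆ Ioo a b) : ∃ a' b', a < a' ∧ b' < b ∧ K ⊆ Icc a' b' := by
  rcases K.eq_empty_or_nonempty with rfl | hne
  · exact ⟨(a + b) / 2, (a + b) / 2, by linarith, by linarith, empty_subset _⟩
  · obtain ⟨c, hc⟩ := hK.exists_isLeast hne
    obtain ⟨d, hd⟩ := hK.exists_isGreatest hne
    exact ⟨c, d, (h hc.1).1, (h hd.1).2, fun x hx => ⟨hc.2 hx, hd.2 hx⟩⟩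

/-- A test function with vanishing integral is the derivative of a test function. -/
lemma IsTest.exists_primitive {a b : ℝ} (hab : a < b) {η : ℝ → ℂ} (hη : IsTest (Ioo a b) η)
    (h0 : ∫ x, η x = 0) : ∃ χ, IsTest (Ioo a b) χ ∧ _root_.deriv χ = η := by
  obtain ⟨a', b', ha, hb, hK⟩ := exists_Icc_of_isCompact_subset_Ioo hab hη.compact hη.subset
  have hz : ∀ x, x ∉ Icc a' b' → η x = 0 := fun x hx =>
    image_eq_zero_of_notMem_tsupport fun h => hx (hK h)
  set χ : ℝ → ℂ := fun x => ∫ t in Iic x, η t with hχ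
  have hd : ∀ x, HasDerivAt χ (η x) x := fun x => by
    have h1 : χ = fun x => (∫ t in Iic (0 : ℝ), η t) + ∫ t in (0 : ℝ)..x, η t := by
      funext y
      rw [← intervalIntegral.integral_Iic_sub_Iic hη.integrable.integrableOn
        hη.integrable.integrableOn, add_sub_cancel]
    rw [h1]
    exact (intervalIntegral.integral_hasDerivAt_right hη.integrable.intervalIntegrable
      (hη.contDiff.continuous.stronglyMeasurableAtFilter _ _)
      hη.contDiff.continuous.continuousAt).const_add _
  have hder : _root_.deriv χ = η := funext fun x => (hd x).deriv
  have hsup : ∀ x, x ∉ Icc a' b' → χ x = 0 := fun x hx => by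
    rcases lt_or_ge x a' with h | h
    · rw [hχ]
      simp only
      rw [setIntegral_eq_zero_of_forall_eq_zero]
      intro t ht
      exact hz t fun h' => absurd h'.1 (not_le.2 (lt_of_le_of_lt ht h))
    · have hx' : b' < x := by
        by_contra hc
        exact hx ⟨h, not_lt.1 hc⟩
      rw [hχ]
      simp only
      rw [setIntegral_eq_integral_of_forall_compl_eq_zero, h0]
      intro t ht
      exact hz t fun h' => ht (h'.2.trans hx'.le)
  have hts : tsupport χ ⊆ Icc a' b' :=
    closure_minimal (fun x hx => by_contra fun h => hx (hsup x h)) isClosed_Icc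
  refine ⟨χ, ⟨contDiff_infty_iff_deriv.2 ⟨fun x => (hd x).differentiableAt, ?_⟩,
    isCompact_Icc.of_isClosed_subset (isClosed_tsupport _) hts,
    hts.trans (Icc_subset_Ioo ha hb)⟩, hder⟩
  rw [hder]
  exact hη.contDiff

lemma exists_isTest_integral_eq_one {a b : ℝ} (hab : a < b) :
    ∃ η : ℝ → ℂ, IsTest (Ioo a b) η ∧ ∫ x, η x = 1 := by
  let f : ContDiffBump ((a + b) / 2 : ℝ) := ⟨(b - a) / 8, (b - a) / 4, by linarith, by linarith⟩
  have hsub : tsupport (fun x => ((f.normed volume x : ℝ) : ℂ))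
      ⊆ tsupport (f.normed volume) :=
    closure_mono fun x hx h => hx (by simp only [h, Complex.ofReal_zero])
  refine ⟨fun x => ((f.normed volume x : ℝ) : ℂ),
    ⟨Complex.ofRealCLM.contDiff.comp f.contDiff_normed,
      f.hasCompactSupport_normed.of_isClosed_subset (isClosed_tsupport _) hsub, ?_⟩, ?_⟩
  · rw [f.tsupport_normed_eq] at hsub
    refine hsub.trans fun x hx => ?_
    rw [Metric.mem_closedBall, Real.dist_eq, abs_le] at hx
    change -((b - a) / 4) ≤ _ ∧ _ ≤ (b - a) / 4 at hx
    constructor <;> linarith [hx.1, hx.2]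
  · rw [integral_complex_ofReal, f.integral_normed, Complex.ofReal_one]

/-- A continuous function annihilating all test functions vanishes. -/
lemma eqOn_zero_of_forall_integral_eq_zero {a b : ℝ} {g : ℝ → ℂ} (hg : ContinuousOn g (Ioo a b))
    (h : ∀ η, IsTest (Ioo a b) η → ∫ x, g x * η x = 0) : EqOn g 0 (Ioo a b) := by
  have h1 := isOpen_Ioo.ae_eq_zero_of_integral_contDiff_smul_eq_zero (f := g) (μ := volume)
    (hg.locallyIntegrableOn measurableSet_Ioo) fun η h1 h2 h3 => by
      have hsub : tsupport (fun x => ((η x : ℝ) : ℂ)) ⊆ tsupport η :=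
        closure_mono fun x hx h => hx (by simp only [h, Complex.ofReal_zero])
      have := h (fun x => η x) ⟨Complex.ofRealCLM.contDiff.comp h1,
        h2.of_isClosed_subset (isClosed_tsupport _) hsub, hsub.trans h3⟩
      rw [← this]
      refine integral_congr_ae (ae_of_all _ fun x => ?_)
      simp only [Complex.real_smul]
      ring
  refine Measure.eqOn_open_of_ae_eq (μ := volume) ?_ isOpen_Ioo hg continuousOn_const
  exact (ae_restrict_iff' measurableSet_Ioo).2 h1

/-- The du Bois-Reymond lemma. -/
lemma exists_eqOn_const_of_forall_integral_deriv_eq_zero {a b : ℝ} (hab : a < b) {g : ℝ → ℂ}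
    (hg : ContinuousOn g (Ioo a b))
    (h : ∀ χ, IsTest (Ioo a b) χ → ∫ x, g x * deriv χ x = 0) :
    ∃ c, ∀ x ∈ Ioo a b, g x = c := by
  obtain ⟨η₀, hη₀, h1⟩ := exists_isTest_integral_eq_one hab
  set c := ∫ x, g x * η₀ x with hc
  refine ⟨c, fun x hx => ?_⟩
  refine sub_eq_zero.1 (eqOn_zero_of_forall_integral_eq_zero (g := fun x => g x - c)
    (hg.sub continuousOn_const) (fun η hη => ?_) hx)
  obtain ⟨χ, hχ, hd⟩ := (hη.sub (hη₀.const_mul (∫ x, η x))).exists_primitive hab (by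
    rw [integral_sub hη.integrable (hη₀.const_mul _).integrable, integral_const_mul, h1, mul_one,
      sub_self])
  have h2 := h χ hχ
  have i1 := hη.integrable_mul (μ := volume) isOpen_Ioo hg
  have i2 := hη₀.integrable_mul (μ := volume) isOpen_Ioo hg
  have e1 : ∀ x, g x * deriv χ x = g x * η x - (∫ x, η x) * (g x * η₀ x) := fun x => by
    rw [hd]; ring
  simp_rw [e1] at h2
  rw [integral_sub i1 (i2.const_mul _), integral_const_mul, ← hc] at h2
  have e2 : ∀ x, (g x - c) * η x = g x * η x - c * η x := fun x => by ring
  simp_rw [e2]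
  rw [integral_sub i1 (hη.integrable.const_mul c), integral_const_mul]
  linear_combination h2

/-- The second order du Bois-Reymond lemma for the operator `(w χ')'`. -/
lemma exists_eqOn_add_mul_of_forall_integral_eq_zero {a b : ℝ} (hab : a < b) {g w B : ℝ → ℂ}
    (hg : ContinuousOn g (Ioo a b)) (hw : ContDiffOn ℝ ∞ w (Ioo a b))
    (hw0 : ∀ x ∈ Ioo a b, w x ≠ 0) (hB : ∀ x ∈ Ioo a b, HasDerivAt B (w x)⁻¹ x)
    (h : ∀ χ, IsTest (Ioo a b) χ → ∫ x, g x * deriv (fun y => w y * deriv χ y) x = 0) :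
    ∃ c₀ c₁, ∀ x ∈ Ioo a b, g x = c₀ + c₁ * B x := by
  obtain ⟨η₀, hη₀, h1⟩ := exists_isTest_integral_eq_one hab
  have hwi : ContDiffOn ℝ ∞ (fun x => (w x)⁻¹) (Ioo a b) := hw.inv hw0
  have Bc : ContinuousOn B (Ioo a b) := fun x hx => (hB x hx).continuousAt.continuousWithinAt
  set ε₀ := fun x => w x * η₀ x with hε₀
  have tε₀ : IsTest (Ioo a b) ε₀ := hη₀.mul isOpen_Ioo hw
  set c₁ := ∫ x, g x * deriv ε₀ x with hc₁
  have hmul : ∀ {η : ℝ → ℂ}, IsTest (Ioo a b) η → ∀ x, w x * ((w x)⁻¹ * η x) = η x := by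
    intro η hη x
    by_cases hx : x ∈ Ioo a b
    · rw [mul_inv_cancel_left₀ (hw0 x hx)]
    · rw [hη.apply_eq_zero hx, mul_zero, mul_zero]
  -- A test function ε has the form w χ' exactly when ε/w has mean zero. Subtracting s ε₀, where
  -- ε₀/w = η₀ has mean one, achieves this. Integrating by parts with B then leaves the first-order
  -- lemma for g + c₁ B.
  have key : ∀ ε, IsTest (Ioo a b) ε →
      ∫ x, g x * deriv ε x = c₁ * ∫ x, (w x)⁻¹ * ε x := fun ε hε => by
    set s := ∫ x, (w x)⁻¹ * ε x with hs
    have t1 : IsTest (Ioo a b) (fun x => (w x)⁻¹ * ε x - s * η₀ x) :=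
      (hε.mul isOpen_Ioo hwi).sub (hη₀.const_mul s)
    obtain ⟨χ, hχ, hd⟩ := t1.exists_primitive hab (by
      rw [integral_sub (hε.mul isOpen_Ioo hwi).integrable (hη₀.const_mul _).integrable,
        integral_const_mul, h1, mul_one, sub_self])
    have h2 := h χ hχ
    have e1 : (fun y => w y * deriv χ y) = fun y => ε y - s * ε₀ y := by
      funext y
      rw [hd, mul_sub, hmul hε, hε₀]
      ring
    have e2 : ∀ x, g x * deriv (fun y => w y * deriv χ y) x
        = g x * deriv ε x - s * (g x * deriv ε₀ x) := fun x => by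
      rw [e1, ((hε.hasDerivAt x).fun_sub ((tε₀.hasDerivAt x).const_mul s)).deriv]
      ring
    simp_rw [e2] at h2
    rw [integral_sub (hε.deriv.integrable_mul isOpen_Ioo hg)
      ((tε₀.deriv.integrable_mul isOpen_Ioo hg).const_mul _), integral_const_mul] at h2
    linear_combination h2
  have parts : ∀ ε, IsTest (Ioo a b) ε →
      ∫ x, (w x)⁻¹ * ε x = -∫ x, B x * deriv ε x := fun ε hε => by
    have i1 := (hε.mul isOpen_Ioo hwi).integrable (μ := volume)
    have i2 := hε.deriv.integrable_mul (μ := volume) isOpen_Ioo Bc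
    have hd : ∀ x, HasDerivAt (fun x => B x * ε x) ((w x)⁻¹ * ε x + B x * deriv ε x) x := by
      intro x
      by_cases hx : x ∈ tsupport ε
      · exact (hB x (hε.subset hx)).fun_mul (hε.hasDerivAt x)
      · have hev := notMem_tsupport_iff_eventuallyEq.1 hx
        have h0 : ε x = 0 := image_eq_zero_of_notMem_tsupport hx
        have h0' : deriv ε x = 0 :=
          image_eq_zero_of_notMem_tsupport fun h => hx (tsupport_deriv_subset h)
        rw [h0, h0', mul_zero, mul_zero, add_zero]
        refine (hasDerivAt_const x (0 : ℂ)).congr_of_eventuallyEq ?_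
        filter_upwards [hev] with y hy
        rw [hy, Pi.zero_apply, mul_zero]
    have := integral_eq_zero_of_hasDerivAt_of_integrable hd (i1.add i2)
      (hε.integrable_mul isOpen_Ioo Bc)
    rw [integral_add i1 i2] at this
    linear_combination this
  obtain ⟨c₀, hc₀⟩ := exists_eqOn_const_of_forall_integral_deriv_eq_zero hab
    (g := fun x => g x + c₁ * B x) (hg.add (continuousOn_const.mul Bc)) fun ε hε => by
      have e : ∀ x, (g x + c₁ * B x) * deriv ε x
          = g x * deriv ε x + c₁ * (B x * deriv ε x) := fun x => by ring
      simp_rw [e]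
      rw [integral_add (hε.deriv.integrable_mul isOpen_Ioo hg)
        ((hε.deriv.integrable_mul isOpen_Ioo Bc).const_mul _), integral_const_mul, key ε hε,
        parts ε hε]
      ring
  exact ⟨c₀, -c₁, fun x hx => by linear_combination hc₀ x hx⟩

/-! ### The complex compression coordinate in the layer -/

lemma T_nonneg {R₁ R₂ r : ℝ} (hr : r ∈ Ico R₁ R₂) : 0 ≤ T R₁ R₂ r :=
  div_nonneg (mul_nonneg (by linarith [hr.1, hr.2]) (by linarith [hr.1])) (by linarith [hr.2])

lemma T_pos {R₁ R₂ r : ℝ} (hr : r ∈ Ioo R₁ R₂) : 0 < T R₁ R₂ r :=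
  div_pos (mul_pos (by linarith [hr.1, hr.2]) (by linarith [hr.1])) (by linarith [hr.2])

/-- The derivative of `T`. -/
noncomputable def T' (R₁ R₂ r : ℝ) : ℝ := (R₂ - R₁) ^ 2 / (R₂ - r) ^ 2

lemma T'_pos {R₁ R₂ r : ℝ} (hr : r ∈ Ioo R₁ R₂) : 0 < T' R₁ R₂ r := by
  have h1 : 0 < R₂ - R₁ := by linarith [hr.1, hr.2]
  have h2 : 0 < R₂ - r := by linarith [hr.2]
  unfold T'
  positivity

lemma hasDerivAt_T {R₁ R₂ r : ℝ} (hr : r ∈ Ioo R₁ R₂) :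
    HasDerivAt (T R₁ R₂) (T' R₁ R₂ r) r := by
  have h2 : R₂ - r ≠ 0 := by linarith [hr.2]
  have := (((hasDerivAt_id' r).sub_const R₁).const_mul (R₂ - R₁)).fun_div
    ((hasDerivAt_id' r).const_sub R₂) h2
  refine this.congr_deriv ?_
  rw [T']
  congr 1
  ring

lemma tendsto_T {R₁ R₂ : ℝ} (hR : R₁ < R₂) : Tendsto (T R₁ R₂) (𝓝[<] R₂) atTop := by
  have h1 : Tendsto (fun r => (R₂ - R₁) * (r - R₁)) (𝓝[<] R₂) (𝓝 ((R₂ - R₁) * (R₂ - R₁))) := by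
    refine Tendsto.mono_left ?_ nhdsWithin_le_nhds
    exact Continuous.tendsto (by fun_prop) R₂
  have h2 : Tendsto (fun r => (R₂ - r)⁻¹) (𝓝[<] R₂) atTop := by
    refine tendsto_inv_nhdsGT_zero.comp (tendsto_nhdsWithin_iff.2 ⟨?_, ?_⟩)
    · refine Tendsto.mono_left ?_ nhdsWithin_le_nhds
      have : Continuous fun r : ℝ => R₂ - r := by fun_prop
      simpa using this.tendsto R₂
    · filter_upwards [self_mem_nhdsWithin] with r hr
      exact sub_pos.2 (mem_Iio.1 hr)
  have hpos : 0 < (R₂ - R₁) * (R₂ - R₁) := mul_pos (by linarith) (by linarith)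
  exact h1.pos_mul_atTop hpos h2

section Layer
variable {R₁ R₂ σ₀ σ₁ r : ℝ}

lemma S_eq (hr : R₁ < r) :
    S R₁ R₂ σ₀ σ₁ r = R₁ + (σ₁ + Complex.I * σ₀) * (T R₁ R₂ r : ℂ) := by
  rw [S, if_neg (not_le.2 hr)]
  ring

lemma S_re (hr : R₁ < r) : (S R₁ R₂ σ₀ σ₁ r).re = R₁ + σ₁ * T R₁ R₂ r := by
  rw [S_eq hr]
  simp

lemma S_im (hr : R₁ < r) : (S R₁ R₂ σ₀ σ₁ r).im = σ₀ * T R₁ R₂ r := by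
  rw [S_eq hr]
  simp

lemma hasDerivAt_S (hr : r ∈ Ioo R₁ R₂) :
    HasDerivAt (S R₁ R₂ σ₀ σ₁) ((σ₁ + Complex.I * σ₀) * (T' R₁ R₂ r : ℂ)) r := by
  have h := ((hasDerivAt_T hr).ofReal_comp.const_mul (σ₁ + Complex.I * σ₀)).const_add (R₁ : ℂ)
  refine h.congr_of_eventuallyEq ?_
  filter_upwards [Ioi_mem_nhds hr.1] with y hy
  exact S_eq hy

lemma α_eq (hr : r ∈ Ioo R₁ R₂) :
    α R₁ R₂ σ₀ σ₁ r = (σ₁ + Complex.I * σ₀) * (T' R₁ R₂ r : ℂ) := (hasDerivAt_S hr).deriv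

lemma hasDerivAt_S' (hr : r ∈ Ioo R₁ R₂) :
    HasDerivAt (S R₁ R₂ σ₀ σ₁) (α R₁ R₂ σ₀ σ₁ r) r := by
  rw [α_eq hr]
  exact hasDerivAt_S hr

lemma S_ne_zero (hσ₀ : 0 < σ₀) (hr : r ∈ Ioo R₁ R₂) : S R₁ R₂ σ₀ σ₁ r ≠ 0 := fun h => by
  have h1 := S_im (R₂ := R₂) (σ₀ := σ₀) (σ₁ := σ₁) hr.1
  rw [h, Complex.zero_im] at h1
  exact (mul_pos hσ₀ (T_pos hr)).ne h1

lemma α_ne_zero (hσ₀ : 0 < σ₀) (hr : r ∈ Ioo R₁ R₂) : α R₁ R₂ σ₀ σ₁ r ≠ 0 := by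
  rw [α_eq hr]
  refine mul_ne_zero (fun h => ?_) (by exact_mod_cast (T'_pos hr).ne')
  have := congrArg Complex.im h
  simp at this
  exact hσ₀.ne' this

lemma contDiffOn_S : ContDiffOn ℝ ∞ (S R₁ R₂ σ₀ σ₁) (Ioo R₁ R₂) := by
  have h1 : ContDiffOn ℝ ∞ (T R₁ R₂) (Ioo R₁ R₂) := by
    unfold T
    exact ContDiffOn.div (by fun_prop) (by fun_prop) fun x hx => by linarith [hx.2]
  have h2 : ContDiffOn ℝ ∞
      (fun r => R₁ + (σ₁ + Complex.I * σ₀) * (T R₁ R₂ r : ℂ)) (Ioo R₁ R₂) :=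
    contDiffOn_const.add (contDiffOn_const.mul (Complex.ofRealCLM.contDiff.comp_contDiffOn h1))
  exact h2.congr fun x hx => S_eq hx.1

lemma contDiffOn_α : ContDiffOn ℝ ∞ (α R₁ R₂ σ₀ σ₁) (Ioo R₁ R₂) := by
  have h1 : ContDiffOn ℝ ∞ (T' R₁ R₂) (Ioo R₁ R₂) := by
    unfold T'
    exact ContDiffOn.div (by fun_prop) (by fun_prop) fun x hx => by
      have : 0 < R₂ - x := by linarith [hx.2]
      positivity
  have h2 : ContDiffOn ℝ ∞
      (fun r => (σ₁ + Complex.I * σ₀) * (T' R₁ R₂ r : ℂ)) (Ioo R₁ R₂) :=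
    contDiffOn_const.mul (Complex.ofRealCLM.contDiff.comp_contDiffOn h1)
  exact h2.congr fun x hx => α_eq hx

end Layer

/-! ### Uniqueness of bounded solutions of the radial equation -/

/-- A positive solution of `Φ' ≥ ℓ' Φ²` with `ℓ → ∞` blows up. -/
lemma nonpos_of_riccati {r₁ R₂ : ℝ} (hr : r₁ < R₂) {Φ Φ' ℓ ℓ' : ℝ → ℝ}
    (hΦ : ∀ r ∈ Ico r₁ R₂, HasDerivAt Φ (Φ' r) r) (hℓ : ∀ r ∈ Ico r₁ R₂, HasDerivAt ℓ (ℓ' r) r)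
    (hℓ0 : ∀ r ∈ Ico r₁ R₂, 0 ≤ ℓ' r) (h : ∀ r ∈ Ico r₁ R₂, ℓ' r * Φ r ^ 2 ≤ Φ' r)
    (hlim : Tendsto ℓ (𝓝[<] R₂) atTop) : Φ r₁ ≤ 0 := by
  by_contra! hpos
  have hint : interior (Ico r₁ R₂) ⊆ Ico r₁ R₂ := interior_subset
  have mono : MonotoneOn Φ (Ico r₁ R₂) := by
    refine monotoneOn_of_deriv_nonneg (convex_Ico _ _)
      (fun r hr => (hΦ r hr).continuousAt.continuousWithinAt)
      (fun r hr => (hΦ r (hint hr)).differentiableAt.differentiableWithinAt) fun r hr => ?_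
    rw [(hΦ r (hint hr)).deriv]
    exact (mul_nonneg (hℓ0 r (hint hr)) (sq_nonneg _)).trans (h r (hint hr))
  have hmem : r₁ ∈ Ico r₁ R₂ := ⟨le_rfl, hr⟩
  have Φpos : ∀ r ∈ Ico r₁ R₂, 0 < Φ r := fun r hr => hpos.trans_le (mono hmem hr hr.1)
  have hd : ∀ r ∈ Ico r₁ R₂,
      HasDerivAt (fun r => (Φ r)⁻¹ + ℓ r) (-Φ' r / Φ r ^ 2 + ℓ' r) r := fun r hr =>
    ((hΦ r hr).fun_inv (Φpos r hr).ne').fun_add (hℓ r hr)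
  -- If Φ were positive, Φ' ≥ ℓ' Φ² would say that 1/Φ + ℓ does not increase, although 1/Φ > 0 and ℓ
  -- tends to infinity.
  have anti : AntitoneOn (fun r => (Φ r)⁻¹ + ℓ r) (Ico r₁ R₂) := by
    refine antitoneOn_of_deriv_nonpos (convex_Ico _ _)
      (fun r hr => (hd r hr).continuousAt.continuousWithinAt)
      (fun r hr => (hd r (hint hr)).differentiableAt.differentiableWithinAt) fun r hr => ?_
    rw [(hd r (hint hr)).deriv]
    have h1 := Φpos r (hint hr)
    have h2 : ℓ' r ≤ Φ' r / Φ r ^ 2 := by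
      rw [le_div_iff₀ (by positivity)]
      exact h r (hint hr)
    rw [neg_div]
    linarith
  have h1 := hlim.eventually_gt_atTop ((Φ r₁)⁻¹ + ℓ r₁)
  have h2 : ∀ᶠ r in 𝓝[<] R₂, r ∈ Ico r₁ R₂ := Ico_mem_nhdsLT hr
  obtain ⟨r, h3, h4⟩ := (h1.and h2).exists
  have h5 := anti hmem h4 h4.1
  have h6 := inv_pos.2 (Φpos r h4)
  simp only at h5
  linarith

/-- The identity for the derivative of `re (i ω̄ m v̄)` with `ω = σ₁ + i σ₀`. -/
lemma flux_identity (k ν R₁ t t' σ₀ σ₁ : ℝ) (v m s κ : ℂ) (hκ : κ = σ₁ + Complex.I * σ₀)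
    (hs : s = R₁ + κ * (t : ℂ)) (hs0 : s ≠ 0) :
    (Complex.I * starRingEnd ℂ κ * (-(κ * (t' : ℂ) * (k ^ 2 * s - ν ^ 2 / s)) * v * starRingEnd ℂ v
      + m * starRingEnd ℂ (m * (κ * (t' : ℂ) / s)))).re
    = t' * ((σ₁ ^ 2 + σ₀ ^ 2) * σ₀ * t * (k ^ 2 + ν ^ 2 / ‖s‖ ^ 2) * ‖v‖ ^ 2
      + (2 * σ₀ * σ₁ * R₁ + σ₀ * (σ₁ ^ 2 + σ₀ ^ 2) * t) / ‖s‖ ^ 2 * ‖m‖ ^ 2) := by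
  have hN : 0 < ‖s‖ ^ 2 := by positivity
  set N := ‖s‖ ^ 2 with hNdef
  have hN0 : (N : ℂ) ≠ 0 := by exact_mod_cast hN.ne'
  have hsN : s * starRingEnd ℂ s = N := by rw [Complex.mul_conj, hNdef, Complex.sq_norm]
  have hinv : s⁻¹ = starRingEnd ℂ s / N := by
    rw [← hsN]
    have : starRingEnd ℂ s ≠ 0 := by simpa using hs0
    field_simp
  have hκκ : κ * starRingEnd ℂ κ = ((σ₁ ^ 2 + σ₀ ^ 2 : ℝ) : ℂ) := by
    rw [Complex.mul_conj, hκ, Complex.normSq_apply]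
    simp
    ring
  have hvv : v * starRingEnd ℂ v = ((‖v‖ ^ 2 : ℝ) : ℂ) := by rw [Complex.mul_conj, Complex.sq_norm]
  have hmm : m * starRingEnd ℂ m = ((‖m‖ ^ 2 : ℝ) : ℂ) := by rw [Complex.mul_conj, Complex.sq_norm]
  -- The factor i κ̄ in the flux is chosen so that all terms acquire a sign: Re(-is) = Re(i s̄) = Im
  -- s = σ₀ t, and Re(i κ̄² s) = 2σ₀σ₁R₁ + σ₀(σ₁² + σ₀²) t.
  have e : Complex.I * starRingEnd ℂ κ *
      (-(κ * (t' : ℂ) * (k ^ 2 * s - ν ^ 2 / s)) * v * starRingEnd ℂ v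
      + m * starRingEnd ℂ (m * (κ * (t' : ℂ) / s)))
      = ((t' * (σ₁ ^ 2 + σ₀ ^ 2) * ‖v‖ ^ 2 : ℝ) : ℂ)
        * (-Complex.I * ((k ^ 2 : ℝ) : ℂ) * s
          + Complex.I * ((ν ^ 2 / N : ℝ) : ℂ) * starRingEnd ℂ s)
      + ((t' * ‖m‖ ^ 2 / N : ℝ) : ℂ) * (Complex.I * starRingEnd ℂ κ * starRingEnd ℂ κ * s) := by
    rw [div_eq_mul_inv _ s, div_eq_mul_inv _ s, hinv]
    simp only [map_mul, map_div₀, Complex.conj_conj, Complex.conj_ofReal]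
    simp only [Complex.ofReal_mul, Complex.ofReal_div, ← hκκ, ← hvv, ← hmm]
    push_cast
    ring
  have sre : s.re = R₁ + σ₁ * t := by rw [hs, hκ]; simp
  have sim : s.im = σ₀ * t := by rw [hs, hκ]; simp
  have κre : κ.re = σ₁ := by rw [hκ]; simp
  have κim : κ.im = σ₀ := by rw [hκ]; simp
  rw [e, Complex.add_re, Complex.re_ofReal_mul, Complex.re_ofReal_mul]
  simp only [Complex.add_re, Complex.mul_re, Complex.mul_im, Complex.neg_re, Complex.neg_im,
    Complex.I_re, Complex.I_im, Complex.ofReal_re, Complex.ofReal_im, Complex.conj_re,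
    Complex.conj_im, sre, sim, κre, κim]
  field_simp
  ring

/-- A solution `v` of the radial equation in the layer, `m = (S / α) v'` being its flux. -/
structure IsRadialSolution (k R₁ R₂ σ₀ σ₁ ν : ℝ) (v m : ℝ → ℂ) : Prop where
  deriv_v : ∀ r ∈ Ioo R₁ R₂,
    HasDerivAt v (m r * (α R₁ R₂ σ₀ σ₁ r / S R₁ R₂ σ₀ σ₁ r)) r
  deriv_m : ∀ r ∈ Ioo R₁ R₂, HasDerivAt m
    (-(α R₁ R₂ σ₀ σ₁ r * (k ^ 2 * S R₁ R₂ σ₀ σ₁ r - ν ^ 2 / S R₁ R₂ σ₀ σ₁ r)) * v r) r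

section Uniqueness
variable {k R₁ R₂ σ₀ σ₁ ν : ℝ} {v m : ℝ → ℂ}

/-- The energy flux `re (i ω̄ m v̄)`. -/
noncomputable def flux (σ₀ σ₁ : ℝ) (v m : ℝ → ℂ) (r : ℝ) : ℝ :=
  (Complex.I * starRingEnd ℂ (σ₁ + Complex.I * σ₀) * (m r * starRingEnd ℂ (v r))).re

/-- The derivative of the energy flux. -/
noncomputable def flux' (k R₁ R₂ σ₀ σ₁ ν : ℝ) (v m : ℝ → ℂ) (r : ℝ) : ℝ :=
  T' R₁ R₂ r * ((σ₁ ^ 2 + σ₀ ^ 2) * σ₀ * T R₁ R₂ r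
      * (k ^ 2 + ν ^ 2 / ‖S R₁ R₂ σ₀ σ₁ r‖ ^ 2) * ‖v r‖ ^ 2
    + (2 * σ₀ * σ₁ * R₁ + σ₀ * (σ₁ ^ 2 + σ₀ ^ 2) * T R₁ R₂ r)
      / ‖S R₁ R₂ σ₀ σ₁ r‖ ^ 2 * ‖m r‖ ^ 2)

lemma IsRadialSolution.hasDerivAt_flux (h : IsRadialSolution k R₁ R₂ σ₀ σ₁ ν v m) (hσ₀ : 0 < σ₀)
    {r : ℝ} (hr : r ∈ Ioo R₁ R₂) :
    HasDerivAt (flux σ₀ σ₁ v m) (flux' k R₁ R₂ σ₀ σ₁ ν v m r) r := by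
  have h1 : HasDerivAt (fun r => starRingEnd ℂ (v r)) _ r := (h.deriv_v r hr).star
  have h2 := ((h.deriv_m r hr).fun_mul h1).const_mul
    (Complex.I * starRingEnd ℂ (σ₁ + Complex.I * σ₀))
  have h3 := Complex.reCLM.hasFDerivAt.comp_hasDerivAt r h2
  refine h3.congr_deriv ?_
  rw [flux', ← flux_identity k ν R₁ (T R₁ R₂ r) (T' R₁ R₂ r) σ₀ σ₁ (v r) (m r)
    (S R₁ R₂ σ₀ σ₁ r) _ rfl (S_eq hr.1) (S_ne_zero hσ₀ hr), ← α_eq hr]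
  rfl

/-- Boundedness of v gives Φ² ≤ const · |m|², while the |m|² term of Φ' has a coefficient at least
const · T'/(1+T), because |S|² grows at most like (1+T)². Since log(1+T) tends to infinity at R₂,
the Riccati argument applies. -/
lemma IsRadialSolution.flux_nonpos (h : IsRadialSolution k R₁ R₂ σ₀ σ₁ ν v m) (hR₁ : 0 < R₁)
    (hσ₀ : 0 < σ₀) (hσ₁ : 0 < σ₁) {M r₁ : ℝ} (hr₁ : r₁ ∈ Ioo R₁ R₂)
    (hM : ∀ r ∈ Ico r₁ R₂, ‖v r‖ ≤ M) : flux σ₀ σ₁ v m r₁ ≤ 0 := by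
  -- The constant c below divides by the bound on v; M itself could be zero.
  have hM1 : 0 < M + 1 := by
    have := (norm_nonneg _).trans (hM r₁ ⟨le_rfl, hr₁.2⟩)
    linarith
  set W := σ₁ ^ 2 + σ₀ ^ 2 with hW
  set A := (R₁ + σ₁) ^ 2 + σ₀ ^ 2 with hA
  set B := min (2 * σ₀ * σ₁ * R₁) (σ₀ * W) with hB
  have hW0 : 0 < W := by positivity
  have hA0 : 0 < A := by positivity
  have hB0 : 0 < B := lt_min (by positivity) (by positivity)
  set c := B / (A * W * (M + 1) ^ 2) with hc
  have hc0 : 0 < c := by positivity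
  have hsub : ∀ r ∈ Ico r₁ R₂, r ∈ Ioo R₁ R₂ := fun r hr => ⟨hr₁.1.trans_le hr.1, hr.2⟩
  refine nonpos_of_riccati hr₁.2 (ℓ := fun r => c * Real.log (1 + T R₁ R₂ r))
    (ℓ' := fun r => c * (T' R₁ R₂ r / (1 + T R₁ R₂ r)))
    (fun r hr => h.hasDerivAt_flux hσ₀ (hsub r hr)) (fun r hr => ?_) (fun r hr => ?_)
    (fun r hr => ?_) ?_
  · have hT := T_pos (hsub r hr)
    exact (((hasDerivAt_T (hsub r hr)).const_add 1).log (by linarith)).const_mul c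
  · have hT := T_pos (hsub r hr)
    have hT' := T'_pos (hsub r hr)
    positivity
  · have hT := T_pos (hsub r hr)
    have hT' := T'_pos (hsub r hr)
    have hs0 := S_ne_zero (σ₁ := σ₁) hσ₀ (hsub r hr)
    have hsn : ‖S R₁ R₂ σ₀ σ₁ r‖ ^ 2 = (R₁ + σ₁ * T R₁ R₂ r) ^ 2 + (σ₀ * T R₁ R₂ r) ^ 2 := by
      rw [Complex.sq_norm, Complex.normSq_apply, S_re (hsub r hr).1, S_im (hsub r hr).1]
      ring
    unfold flux'
    set t := T R₁ R₂ r
    set N := ‖S R₁ R₂ σ₀ σ₁ r‖ ^ 2 with hN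
    have hN0 : 0 < N := by positivity
    have hNle : N ≤ A * (1 + t) ^ 2 := by
      rw [hsn, hA]
      nlinarith [mul_pos hR₁ hT, mul_pos hσ₁ hT, mul_pos hR₁ hσ₁, mul_pos (mul_pos hR₁ hσ₁) hT,
        mul_pos (mul_pos hR₁ hR₁) hT, mul_pos (mul_pos hσ₁ hσ₁) hT, mul_pos (mul_pos hσ₀ hσ₀) hT,
        mul_pos hσ₁ hσ₁, mul_pos hσ₀ hσ₀, mul_pos (mul_pos hR₁ hR₁) (mul_pos hT hT),
        mul_pos (mul_pos hR₁ hσ₁) (mul_pos hT hT)]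
    have hnum : B * (1 + t) ≤ 2 * σ₀ * σ₁ * R₁ + σ₀ * W * t := by
      have h1 : B ≤ 2 * σ₀ * σ₁ * R₁ := min_le_left _ _
      have h2 : B * t ≤ σ₀ * W * t := mul_le_mul_of_nonneg_right (min_le_right _ _) hT.le
      linarith
    have hcoef : B / (A * (1 + t)) ≤ (2 * σ₀ * σ₁ * R₁ + σ₀ * W * t) / N := by
      rw [div_le_div_iff₀ (by positivity) hN0]
      calc B * N ≤ B * (A * (1 + t) ^ 2) := mul_le_mul_of_nonneg_left hNle hB0.le
        _ = B * (1 + t) * (A * (1 + t)) := by ring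
        _ ≤ _ := mul_le_mul_of_nonneg_right hnum (by positivity)
    have hflux : flux σ₀ σ₁ v m r ^ 2 ≤ W * (M + 1) ^ 2 * ‖m r‖ ^ 2 := by
      have h1 : |flux σ₀ σ₁ v m r| ≤ Real.sqrt W * (‖m r‖ * (M + 1)) := by
        refine (Complex.abs_re_le_norm _).trans ?_
        rw [norm_mul, norm_mul, norm_mul, Complex.norm_I, one_mul, RCLike.norm_conj,
          RCLike.norm_conj]
        have hω : ‖(σ₁ : ℂ) + Complex.I * σ₀‖ = Real.sqrt W := by
          rw [Complex.norm_def, Complex.normSq_apply]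
          congr 1
          simp
          ring
        rw [hω]
        have hv : ‖v r‖ ≤ M + 1 := by linarith [hM r hr]
        gcongr
      calc flux σ₀ σ₁ v m r ^ 2 = |flux σ₀ σ₁ v m r| ^ 2 := (sq_abs _).symm
        _ ≤ (Real.sqrt W * (‖m r‖ * (M + 1))) ^ 2 := by gcongr
        _ = W * (M + 1) ^ 2 * ‖m r‖ ^ 2 := by
          rw [mul_pow, Real.sq_sqrt hW0.le]; ring
    calc c * (T' R₁ R₂ r / (1 + t)) * flux σ₀ σ₁ v m r ^ 2
        ≤ c * (T' R₁ R₂ r / (1 + t)) * (W * (M + 1) ^ 2 * ‖m r‖ ^ 2) := by gcongr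
      _ = T' R₁ R₂ r * (B / (A * (1 + t)) * ‖m r‖ ^ 2) := by
        rw [hc]
        field_simp
      _ ≤ T' R₁ R₂ r * ((2 * σ₀ * σ₁ * R₁ + σ₀ * W * t) / N * ‖m r‖ ^ 2) := by gcongr
      _ ≤ _ := by
        have : 0 ≤ W * σ₀ * t * (k ^ 2 + ν ^ 2 / N) * ‖v r‖ ^ 2 := by positivity
        gcongr
        linarith
  · exact (Real.tendsto_log_atTop.comp
      (tendsto_atTop_add_const_left _ 1 (tendsto_T (hr₁.1.trans hr₁.2)))).const_mul_atTop hc0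

/-- A radial solution which is bounded near the outer boundary and vanishes at one point vanishes
from there on. -/
lemma IsRadialSolution.eq_zero (h : IsRadialSolution k R₁ R₂ σ₀ σ₁ ν v m) (hk : 0 < k)
    (hR₁ : 0 < R₁) (hσ₀ : 0 < σ₀) (hσ₁ : 0 < σ₁) {M r₁ r₀ : ℝ} (hr₁ : r₁ < R₂)
    (hM : ∀ r ∈ Ioo r₁ R₂, ‖v r‖ ≤ M) (hr₀ : r₀ ∈ Ioo R₁ R₂) (hv : v r₀ = 0) {r : ℝ}
    (hr : r ∈ Ico r₀ R₂) : v r = 0 := by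
  have hsub : ∀ r ∈ Ico r₀ R₂, r ∈ Ioo R₁ R₂ := fun r hr => ⟨hr₀.1.trans_le hr.1, hr.2⟩
  have hint : interior (Ico r₀ R₂) ⊆ Ico r₀ R₂ := interior_subset
  have hd : ∀ r ∈ Ico r₀ R₂, HasDerivAt (flux σ₀ σ₁ v m) (flux' k R₁ R₂ σ₀ σ₁ ν v m r) r :=
    fun r hr => h.hasDerivAt_flux hσ₀ (hsub r hr)
  have hlow : ∀ r ∈ Ioo R₁ R₂, T' R₁ R₂ r * ((σ₁ ^ 2 + σ₀ ^ 2) * σ₀ * T R₁ R₂ r * k ^ 2)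
      * ‖v r‖ ^ 2 ≤ flux' k R₁ R₂ σ₀ σ₁ ν v m r := fun r hr => by
    have hT := T_pos hr
    have hT' := T'_pos hr
    unfold flux'
    rw [mul_assoc]
    gcongr
    have h1 : 0 ≤ (2 * σ₀ * σ₁ * R₁ + σ₀ * (σ₁ ^ 2 + σ₀ ^ 2) * T R₁ R₂ r)
      / ‖S R₁ R₂ σ₀ σ₁ r‖ ^ 2 * ‖m r‖ ^ 2 := by positivity
    have h2 : 0 ≤ (σ₁ ^ 2 + σ₀ ^ 2) * σ₀ * T R₁ R₂ r * (ν ^ 2 / ‖S R₁ R₂ σ₀ σ₁ r‖ ^ 2)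
      * ‖v r‖ ^ 2 := by positivity
    linarith
  have mono : MonotoneOn (flux σ₀ σ₁ v m) (Ico r₀ R₂) := by
    refine monotoneOn_of_deriv_nonneg (convex_Ico _ _)
      (fun r hr => (hd r hr).continuousAt.continuousWithinAt)
      (fun r hr => (hd r (hint hr)).differentiableAt.differentiableWithinAt) fun r hr => ?_
    rw [(hd r (hint hr)).deriv]
    have hT := T_pos (hsub r (hint hr))
    have hT' := T'_pos (hsub r (hint hr))
    exact le_trans (by positivity) (hlow r (hsub r (hint hr)))
  have hzero : flux σ₀ σ₁ v m r₀ = 0 := by simp [flux, hv]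
  -- The flux is nondecreasing from the value 0 at r₀, and it is nonpositive at points close to R₂,
  -- where v is bounded. Hence it vanishes throughout, and its derivative, which controls |v|²,
  -- vanishes as well.
  have hflux : ∀ r ∈ Ico r₀ R₂, flux σ₀ σ₁ v m r = 0 := fun r hr => by
    obtain ⟨r₂, h1, h2⟩ := exists_between (max_lt hr₁ hr.2)
    have hr₂ : r₂ ∈ Ico r₀ R₂ := ⟨hr.1.trans ((le_max_right _ _).trans h1.le), h2⟩
    have e1 := h.flux_nonpos hR₁ hσ₀ hσ₁ (hsub r₂ hr₂) (M := M)
      fun s hs => hM s ⟨((le_max_left _ _).trans_lt h1).trans_le hs.1, hs.2⟩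
    have e2 := mono hr hr₂ ((le_max_right _ _).trans h1.le)
    have e3 := mono ⟨le_rfl, hr₀.2⟩ hr hr.1
    linarith
  rcases hr.1.eq_or_lt with rfl | hlt
  · exact hv
  · have hd0 : HasDerivAt (flux σ₀ σ₁ v m) 0 r := by
      refine (hasDerivAt_const r (0 : ℝ)).congr_of_eventuallyEq ?_
      filter_upwards [Ioo_mem_nhds hlt hr.2] with y hy
      exact hflux y ⟨hy.1.le, hy.2⟩
    have h1 := (hd r hr).unique hd0
    have h2 := hlow r (hsub r hr)
    rw [h1] at h2
    have hT := T_pos (hsub r hr)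
    have hT' := T'_pos (hsub r hr)
    by_contra hne
    have : 0 < ‖v r‖ := norm_pos_iff.2 hne
    exact absurd h2 (not_le.2 (by positivity))

end Uniqueness

/-! ### Bounded very weak solutions of the radial equation -/

lemma T_mono {R₁ R₂ r₀ r : ℝ} (hR : R₁ < R₂) (h : r₀ ≤ r) (hr : r < R₂) :
    T R₁ R₂ r₀ ≤ T R₁ R₂ r := by
  rw [T, T, div_le_div_iff₀ (by linarith) (by linarith)]
  have h1 : 0 ≤ (R₂ - R₁) * (R₂ - R₁) * (r - r₀) :=
    mul_nonneg (mul_nonneg (by linarith) (by linarith)) (by linarith)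
  linarith

lemma contDiffOn_besselK (ν : ℝ) : ContDiffOn ℂ ∞ (besselK ν) {x : ℂ | 0 < x.re} := by
  refine DifferentiableOn.contDiffOn (fun x hx => ?_)
    (isOpen_lt continuous_const Complex.continuous_re)
  exact (hasDerivAt_besselK ν hx).differentiableAt.differentiableWithinAt

lemma exists_primitive_of_continuousOn {a b : ℝ} {g : ℝ → ℂ} (hab : a < b)
    (hg : ContinuousOn g (Ioo a b)) : ∃ B : ℝ → ℂ, ∀ x ∈ Ioo a b, HasDerivAt B (g x) x := by
  refine ⟨fun x => ∫ t in ((a + b) / 2)..x, g t, fun x hx => ?_⟩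
  have hmid : (a + b) / 2 ∈ Ioo a b := ⟨by linarith, by linarith⟩
  have hsub : uIcc ((a + b) / 2) x ⊆ Ioo a b := (ordConnected_Ioo).uIcc_subset hmid hx
  exact intervalIntegral.integral_hasDerivAt_right (hg.mono hsub).intervalIntegrable
    (hg.stronglyMeasurableAtFilter isOpen_Ioo x hx) (hg.continuousAt (isOpen_Ioo.mem_nhds hx))

section Layer
variable {k R₁ R₂ σ₀ σ₁ ν : ℝ}

/-- The function `K_ν(-i k S(r))`. -/
noncomputable def layerK (k R₁ R₂ σ₀ σ₁ ν r : ℝ) : ℂ :=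
  besselK ν (-(Complex.I * k) * S R₁ R₂ σ₀ σ₁ r)

/-- The flux of `layerK`. -/
noncomputable def layerFlux (k R₁ R₂ σ₀ σ₁ ν r : ℝ) : ℂ :=
  -(Complex.I * k) * S R₁ R₂ σ₀ σ₁ r * besselK' ν (-(Complex.I * k) * S R₁ R₂ σ₀ σ₁ r)

lemma re_layer {r : ℝ} (hr : R₁ < r) :
    (-(Complex.I * k) * S R₁ R₂ σ₀ σ₁ r).re = k * (σ₀ * T R₁ R₂ r) := by
  rw [← S_im (σ₁ := σ₁) hr]
  simp

lemma re_layer_pos (hk : 0 < k) (hσ₀ : 0 < σ₀) {r : ℝ} (hr : r ∈ Ioo R₁ R₂) :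
    0 < (-(Complex.I * k) * S R₁ R₂ σ₀ σ₁ r).re := by
  rw [re_layer hr.1]
  have := T_pos hr
  positivity

/-- With x = -ikS the flux (S/α) v' becomes x K_ν'(x), so the radial equation is (x K')' = (x +
ν²/x) K by the chain rule. -/
lemma isRadialSolution_layerK (hk : 0 < k) (hσ₀ : 0 < σ₀) :
    IsRadialSolution k R₁ R₂ σ₀ σ₁ ν (layerK k R₁ R₂ σ₀ σ₁ ν) (layerFlux k R₁ R₂ σ₀ σ₁ ν) := by
  constructor <;> intro r hr
  all_goals
    have hx := re_layer_pos (σ₁ := σ₁) hk hσ₀ hr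
    have hS := S_ne_zero (σ₁ := σ₁) hσ₀ hr
    have hk0 : (k : ℂ) ≠ 0 := by exact_mod_cast hk.ne'
    have hd := (hasDerivAt_S' (σ₀ := σ₀) (σ₁ := σ₁) hr).const_mul (-(Complex.I * k))
  · refine ((hasDerivAt_besselK ν hx).comp r hd).congr_deriv ?_
    rw [layerFlux]
    field_simp
  · refine ((hasDerivAt_mul_besselK' ν hx).comp r hd).congr_deriv ?_
    rw [layerK]
    generalize besselK ν _ = K
    field_simp
    linear_combination (k ^ 2 * S R₁ R₂ σ₀ σ₁ r ^ 2 * K * α R₁ R₂ σ₀ σ₁ r) * Complex.I_sq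

lemma contDiffOn_S_div_α (hσ₀ : 0 < σ₀) :
    ContDiffOn ℝ ∞ (fun r => S R₁ R₂ σ₀ σ₁ r / α R₁ R₂ σ₀ σ₁ r) (Ioo R₁ R₂) := by
  simp only [div_eq_mul_inv]
  exact contDiffOn_S.mul (contDiffOn_α.inv fun x hx => α_ne_zero hσ₀ hx)

lemma layerK_ne_zero (hk : 0 < k) (hσ₀ : 0 < σ₀) {r : ℝ} (hr : r ∈ Ioo R₁ R₂) :
    layerK k R₁ R₂ σ₀ σ₁ ν r ≠ 0 := besselK_ne_zero ν (re_layer_pos hk hσ₀ hr)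

lemma contDiffOn_layerK (hk : 0 < k) (hσ₀ : 0 < σ₀) :
    ContDiffOn ℝ ∞ (layerK k R₁ R₂ σ₀ σ₁ ν) (Ioo R₁ R₂) :=
  ((contDiffOn_besselK ν).restrict_scalars ℝ).comp (contDiffOn_const.mul contDiffOn_S)
    fun _ hr => re_layer_pos hk hσ₀ hr

lemma norm_sq_S {r : ℝ} (hr : R₁ < r) : ‖S R₁ R₂ σ₀ σ₁ r‖ ^ 2
    = (R₁ + σ₁ * T R₁ R₂ r) ^ 2 + σ₀ ^ 2 * T R₁ R₂ r ^ 2 := by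
  rw [Complex.sq_norm, Complex.normSq_apply, S_re hr, S_im hr]
  ring

/-- `‖S‖²` as a function of `T`. -/
noncomputable def normSqS (R₁ σ₀ σ₁ t : ℝ) : ℝ := (R₁ + σ₁ * t) ^ 2 + σ₀ ^ 2 * t ^ 2

/-- Half of the decay exponent between two values of `T`. -/
noncomputable def decay (k R₁ σ₀ σ₁ t₀ t : ℝ) : ℝ :=
  Real.sqrt ((k ^ 2 * normSqS R₁ σ₀ σ₁ t - k ^ 2 * normSqS R₁ σ₀ σ₁ t₀)
    * (σ₀ ^ 2 * t ^ 2 / normSqS R₁ σ₀ σ₁ t - σ₀ ^ 2 * t₀ ^ 2 / normSqS R₁ σ₀ σ₁ t₀))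

/-- For x = -ikS one has p = k²|S|² and q = (Im S)²/|S|², the squared sine of the argument of S.
Both increase as S moves along its ray from R₁ in the direction σ₁ + iσ₀. -/
lemma norm_sq_layerK_le (hk : 0 < k) (hR₁ : 0 < R₁) (hσ₀ : 0 < σ₀) (hσ₁ : 0 < σ₁) {r₀ r : ℝ}
    (hr₀ : r₀ ∈ Ioo R₁ R₂) (hr : r ∈ Ico r₀ R₂) :
    ‖layerK k R₁ R₂ σ₀ σ₁ ν r‖ ^ 2
      ≤ Real.exp (-(2 * decay k R₁ σ₀ σ₁ (T R₁ R₂ r₀) (T R₁ R₂ r)))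
        * ‖layerK k R₁ R₂ σ₀ σ₁ ν r₀‖ ^ 2 := by
  have hr' : r ∈ Ioo R₁ R₂ := ⟨hr₀.1.trans_le hr.1, hr.2⟩
  have ht₀ := T_pos hr₀
  have ht := T_pos hr'
  have htt := T_mono (hr₀.1.trans hr₀.2) hr.1 hr.2
  have hn : ∀ s ∈ Ioo R₁ R₂, k ^ 2 * normSqS R₁ σ₀ σ₁ (T R₁ R₂ s)
      = ‖-(Complex.I * k) * S R₁ R₂ σ₀ σ₁ s‖ ^ 2 := fun s hs => by
    rw [normSqS, ← norm_sq_S hs.1, norm_mul, norm_neg, norm_mul, Complex.norm_I, one_mul, mul_pow,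
      Complex.norm_real, Real.norm_eq_abs, sq_abs]
  have hN : ∀ t, 0 < t → 0 < normSqS R₁ σ₀ σ₁ t := fun t ht => by
    unfold normSqS
    positivity
  have hq : ∀ s ∈ Ioo R₁ R₂, k ^ 2 * normSqS R₁ σ₀ σ₁ (T R₁ R₂ s)
      * (σ₀ ^ 2 * T R₁ R₂ s ^ 2 / normSqS R₁ σ₀ σ₁ (T R₁ R₂ s))
      = (-(Complex.I * k) * S R₁ R₂ σ₀ σ₁ s).re ^ 2 := fun s hs => by
    rw [re_layer hs.1]
    have := hN _ (T_pos hs)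
    field_simp
  refine norm_sq_besselK_le ν (re_layer_pos hk hσ₀ hr') (re_layer_pos hk hσ₀ hr₀) (hn r hr')
    (hq r hr') (hn r₀ hr₀) (hq r₀ hr₀) ?_ ?_
  · unfold normSqS
    gcongr
  · rw [div_le_div_iff₀ (hN _ ht₀) (hN _ ht)]
    set t₀ := T R₁ R₂ r₀
    set t := T R₁ R₂ r
    -- After the terms in σ₀⁴ cancel, monotonicity of q is that of t/(R₁ + σ₁ t).
    have h1 : t₀ * (R₁ + σ₁ * t) ≤ t * (R₁ + σ₁ * t₀) := by nlinarith
    have h2 : (t₀ * (R₁ + σ₁ * t)) ^ 2 ≤ (t * (R₁ + σ₁ * t₀)) ^ 2 := by gcongr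
    have h3 := mul_le_mul_of_nonneg_left h2 (sq_nonneg σ₀)
    unfold normSqS
    linarith

/-- `u` solves the radial equation in the sense of distributions. -/
def IsVeryWeakRadialSolution (k R₁ R₂ σ₀ σ₁ ν : ℝ) (u : ℝ → ℂ) : Prop :=
  ∀ ψ, IsTest (Ioo R₁ R₂) ψ →
    ∫ r, u r * (deriv (fun y => S R₁ R₂ σ₀ σ₁ y / α R₁ R₂ σ₀ σ₁ y * deriv ψ y) r
      + α R₁ R₂ σ₀ σ₁ r * (k ^ 2 * S R₁ R₂ σ₀ σ₁ r - ν ^ 2 / S R₁ R₂ σ₀ σ₁ r) * ψ r) = 0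

/-- Reduction of order: `L (w χ) = w⁻¹ (P w² χ')'` for a solution `w` of `L w = 0`. -/
lemma reduction_of_order (hk : 0 < k) (hσ₀ : 0 < σ₀) {χ : ℝ → ℂ} (hχ : IsTest (Ioo R₁ R₂) χ)
    (r : ℝ) :
    deriv (fun y => S R₁ R₂ σ₀ σ₁ y / α R₁ R₂ σ₀ σ₁ y
        * deriv (fun x => layerK k R₁ R₂ σ₀ σ₁ ν x * χ x) y) r
      + α R₁ R₂ σ₀ σ₁ r * (k ^ 2 * S R₁ R₂ σ₀ σ₁ r - ν ^ 2 / S R₁ R₂ σ₀ σ₁ r)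
        * (layerK k R₁ R₂ σ₀ σ₁ ν r * χ r)
    = (layerK k R₁ R₂ σ₀ σ₁ ν r)⁻¹ * deriv (fun y => S R₁ R₂ σ₀ σ₁ y / α R₁ R₂ σ₀ σ₁ y
        * layerK k R₁ R₂ σ₀ σ₁ ν y ^ 2 * deriv χ y) r := by
  set w := layerK k R₁ R₂ σ₀ σ₁ ν with hw
  set m := layerFlux k R₁ R₂ σ₀ σ₁ ν
  have hsol := isRadialSolution_layerK (R₁ := R₁) (R₂ := R₂) (σ₁ := σ₁) (ν := ν) hk hσ₀
  by_cases hr : r ∈ tsupport χ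
  · have hrI := hχ.subset hr
    have hα := α_ne_zero (σ₁ := σ₁) hσ₀ hrI
    have hS := S_ne_zero (σ₁ := σ₁) hσ₀ hrI
    have hw0 : w r ≠ 0 := layerK_ne_zero hk hσ₀ hrI
    set G : ℝ → ℂ := fun y => S R₁ R₂ σ₀ σ₁ y / α R₁ R₂ σ₀ σ₁ y * deriv χ y with hG
    have tG : IsTest (Ioo R₁ R₂) G := hχ.deriv.mul isOpen_Ioo
      (contDiffOn_S_div_α hσ₀)
    have dG := tG.hasDerivAt r
    have dw := hsol.deriv_v r hrI
    have dm := hsol.deriv_m r hrI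
    have dχ := hχ.hasDerivAt r
    have e1 : (fun y => S R₁ R₂ σ₀ σ₁ y / α R₁ R₂ σ₀ σ₁ y * deriv (fun x => w x * χ x) y)
        =ᶠ[𝓝 r] fun y => m y * χ y + w y * G y := by
      filter_upwards [isOpen_Ioo.mem_nhds hrI] with y hy
      rw [((hsol.deriv_v y hy).fun_mul (hχ.hasDerivAt y)).deriv, hG]
      have hα := α_ne_zero (σ₁ := σ₁) hσ₀ hy
      have hS := S_ne_zero (σ₁ := σ₁) hσ₀ hy
      simp only [m, w]
      field_simp
    have e2 : (fun y => S R₁ R₂ σ₀ σ₁ y / α R₁ R₂ σ₀ σ₁ y * w y ^ 2 * deriv χ y)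
        = fun y => w y * (w y * G y) := by
      funext y
      rw [hG]
      ring
    rw [e1.deriv_eq, e2, ((dm.fun_mul dχ).fun_add (dw.fun_mul dG)).deriv,
      (dw.fun_mul (dw.fun_mul dG)).deriv]
    simp only [← hw, hG]
    field_simp
    ring
  · have hev := notMem_tsupport_iff_eventuallyEq.1 hr
    have h0 : χ r = 0 := image_eq_zero_of_notMem_tsupport hr
    have e1 : (fun y => S R₁ R₂ σ₀ σ₁ y / α R₁ R₂ σ₀ σ₁ y * deriv (fun x => w x * χ x) y)
        =ᶠ[𝓝 r] fun _ => 0 := by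
      filter_upwards [hev.eventually_nhds] with y hy
      have : (fun x => w x * χ x) =ᶠ[𝓝 y] fun _ => 0 := by
        filter_upwards [hy] with z hz
        rw [hz, Pi.zero_apply, mul_zero]
      rw [this.deriv_eq, deriv_const, mul_zero]
    have e2 : (fun y => S R₁ R₂ σ₀ σ₁ y / α R₁ R₂ σ₀ σ₁ y * w y ^ 2 * deriv χ y)
        =ᶠ[𝓝 r] fun _ => 0 := by
      filter_upwards [hev.eventually_nhds] with y hy
      have : deriv χ y = 0 := by
        rw [Filter.EventuallyEq.deriv_eq (f := fun _ => 0) hy, deriv_const]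
      rw [this, mul_zero]
    rw [e1.deriv_eq, e2.deriv_eq, h0, deriv_const]
    ring

/-- A continuous very weak solution which is bounded near the outer boundary is a multiple of
`layerK`. -/
lemma IsVeryWeakRadialSolution.eq_mul_layerK {u : ℝ → ℂ}
    (h : IsVeryWeakRadialSolution k R₁ R₂ σ₀ σ₁ ν u) (hk : 0 < k) (hR₁ : 0 < R₁) (hR : R₁ < R₂)
    (hσ₀ : 0 < σ₀) (hσ₁ : 0 < σ₁) (hu : ContinuousOn u (Ioo R₁ R₂)) {M r₁ : ℝ} (hr₁ : r₁ < R₂)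
    (hM : ∀ r ∈ Ioo r₁ R₂, ‖u r‖ ≤ M) {r₀ r : ℝ} (hr₀ : r₀ ∈ Ioo R₁ R₂) (hr : r ∈ Ico r₀ R₂) :
    u r = u r₀ / layerK k R₁ R₂ σ₀ σ₁ ν r₀ * layerK k R₁ R₂ σ₀ σ₁ ν r := by
  set w := layerK k R₁ R₂ σ₀ σ₁ ν with hw
  set m := layerFlux k R₁ R₂ σ₀ σ₁ ν
  have hsol := isRadialSolution_layerK (R₁ := R₁) (R₂ := R₂) (σ₁ := σ₁) (ν := ν) hk hσ₀
  have w0 : ∀ r ∈ Ioo R₁ R₂, w r ≠ 0 := fun r hr => layerK_ne_zero hk hσ₀ hr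
  have wd : ContDiffOn ℝ ∞ w (Ioo R₁ R₂) := contDiffOn_layerK hk hσ₀
  set a : ℝ → ℂ := fun r => S R₁ R₂ σ₀ σ₁ r / α R₁ R₂ σ₀ σ₁ r * w r ^ 2 with ha
  have ad : ContDiffOn ℝ ∞ a (Ioo R₁ R₂) :=
    (contDiffOn_S_div_α hσ₀).mul (wd.pow 2)
  have a0 : ∀ r ∈ Ioo R₁ R₂, a r ≠ 0 := fun r hr =>
    mul_ne_zero (div_ne_zero (S_ne_zero hσ₀ hr) (α_ne_zero hσ₀ hr)) (pow_ne_zero 2 (w0 r hr))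
  obtain ⟨B, hB⟩ := exists_primitive_of_continuousOn hR (ad.continuousOn.inv₀ a0)
  -- Testing with w χ and reducing the order leaves (a χ')' tested against u/w, so u/w = c₀ + c₁ B;
  -- in particular u is a classical solution.
  obtain ⟨c₀, c₁, hc⟩ := exists_eqOn_add_mul_of_forall_integral_eq_zero hR
    (g := fun r => u r * (w r)⁻¹) (hu.mul (wd.continuousOn.inv₀ w0)) ad a0 hB fun χ hχ => by
      rw [← h _ (hχ.mul isOpen_Ioo wd)]
      refine integral_congr_ae (ae_of_all _ fun r => ?_)
      simp only
      rw [reduction_of_order hk hσ₀ hχ r, ← hw]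
      ring
  set c := u r₀ / w r₀ with hcdef
  -- This is u - c w, written so that it is visibly differentiable; c makes it vanish at r₀. Its
  -- flux carries the extra term c₁/w because (S/α) w B' = 1/w.
  set v : ℝ → ℂ := fun r => w r * (c₀ - c + c₁ * B r) with hv
  set mv : ℝ → ℂ := fun r => m r * (c₀ - c + c₁ * B r) + c₁ * (w r)⁻¹ with hmv
  have hvu : ∀ r ∈ Ioo R₁ R₂, v r = u r - c * w r := fun r hr => by
    have h1 := hc r hr
    have h2 := w0 r hr
    simp only [hv]
    field_simp at h1
    linear_combination -h1
  have hvsol : IsRadialSolution k R₁ R₂ σ₀ σ₁ ν v mv := by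
    constructor <;> intro r hr
    all_goals
      have hα := α_ne_zero (σ₁ := σ₁) hσ₀ hr
      have hS := S_ne_zero (σ₁ := σ₁) hσ₀ hr
      have hw0 := w0 r hr
      have dw := hsol.deriv_v r hr
      have dm := hsol.deriv_m r hr
      have dB := ((hB r hr).const_mul c₁).const_add (c₀ - c)
    · refine (dw.fun_mul dB).congr_deriv ?_
      simp only [hmv, Pi.inv_apply, ha, ← hw]
      field_simp
      simp only [m]
      ring
    · refine ((dm.fun_mul dB).fun_add ((dw.fun_inv hw0).const_mul c₁)).congr_deriv ?_
      simp only [hv, Pi.inv_apply, ha, ← hw]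
      field_simp
      ring
  -- Beyond r₀ the Bessel argument keeps real part at least kσ₀T(r₀), so w, and with it v, is
  -- bounded.
  have hbd : ∀ r ∈ Ioo (max r₁ r₀) R₂, ‖v r‖ ≤ M + ‖c‖ * ∫ t, Real.exp (ν * t
      - (k * (σ₀ * T R₁ R₂ r₀)) / 2 * Real.exp t
      - (k * (σ₀ * T R₁ R₂ r₀)) / 2 * Real.exp (-t)) := fun r hr => by
    have hr' : r ∈ Ioo R₁ R₂ := ⟨hr₀.1.trans ((le_max_right _ _).trans_lt hr.1), hr.2⟩
    rw [hvu r hr']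
    refine (norm_sub_le _ _).trans (add_le_add (hM r ⟨(le_max_left _ _).trans_lt hr.1, hr.2⟩) ?_)
    rw [norm_mul]
    refine mul_le_mul_of_nonneg_left (norm_besselK_le ν ?_ ?_) (norm_nonneg _)
    · have := T_pos hr₀
      positivity
    · rw [re_layer hr'.1]
      have := T_mono hR ((le_max_right r₁ r₀).trans hr.1.le) hr.2
      gcongr
  have hv0 : v r₀ = 0 := by
    rw [hvu r₀ hr₀, hcdef, div_mul_cancel₀ _ (w0 r₀ hr₀), sub_self]
  have := hvsol.eq_zero hk hR₁ hσ₀ hσ₁ (max_lt hr₁ hr₀.2) hbd hr₀ hv0 hr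
  rw [hvu r ⟨hr₀.1.trans_le hr.1, hr.2⟩] at this
  linear_combination this

/-- The decay of a single mode from `R₁` on. -/
lemma IsVeryWeakRadialSolution.norm_sq_le {u : ℝ → ℂ}
    (h : IsVeryWeakRadialSolution k R₁ R₂ σ₀ σ₁ ν u) (hk : 0 < k) (hR₁ : 0 < R₁)
    (hσ₀ : 0 < σ₀) (hσ₁ : 0 < σ₁) (hu : ContinuousOn u (Ico R₁ R₂)) {M r₁ : ℝ} (hr₁ : r₁ < R₂)
    (hM : ∀ r ∈ Ioo r₁ R₂, ‖u r‖ ≤ M) {r : ℝ} (hr : r ∈ Ioo R₁ R₂) :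
    ‖u r‖ ^ 2 ≤ Real.exp (-(2 * decay k R₁ σ₀ σ₁ 0 (T R₁ R₂ r))) * ‖u R₁‖ ^ 2 := by
  have hR := hr.1.trans hr.2
  -- At R₁ the Bessel argument is purely imaginary, outside the half plane where K_ν is controlled.
  -- The comparison therefore starts at r₀ > R₁, and r₀ → R₁ is taken at the end by continuity of u
  -- and of the exponent.
  have h1 : ∀ r₀ ∈ Ioo R₁ r, ‖u r‖ ^ 2
      ≤ Real.exp (-(2 * decay k R₁ σ₀ σ₁ (T R₁ R₂ r₀) (T R₁ R₂ r))) * ‖u r₀‖ ^ 2 :=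
    fun r₀ hr₀ => by
      have hr₀' : r₀ ∈ Ioo R₁ R₂ := ⟨hr₀.1, hr₀.2.trans hr.2⟩
      have hr' : r ∈ Ico r₀ R₂ := ⟨hr₀.2.le, hr.2⟩
      rw [h.eq_mul_layerK hk hR₁ hR hσ₀ hσ₁ (hu.mono Ioo_subset_Ico_self) hr₁ hM hr₀' hr',
        norm_mul, norm_div, mul_pow, div_pow]
      have hw := layerK_ne_zero (σ₁ := σ₁) (ν := ν) hk hσ₀ hr₀'
      have hw' : 0 < ‖layerK k R₁ R₂ σ₀ σ₁ ν r₀‖ ^ 2 := by positivity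
      have h2 := norm_sq_layerK_le (ν := ν) hk hR₁ hσ₀ hσ₁ hr₀' hr'
      calc _ ≤ ‖u r₀‖ ^ 2 / ‖layerK k R₁ R₂ σ₀ σ₁ ν r₀‖ ^ 2 * _ :=
            mul_le_mul_of_nonneg_left h2 (by positivity)
        _ = _ := by field_simp
  have hT : Tendsto (T R₁ R₂) (𝓝[>] R₁) (𝓝 0) := by
    have hc : ContinuousAt (T R₁ R₂) R₁ := by
      unfold T
      exact ContinuousAt.div (by fun_prop) (by fun_prop) (by linarith)
    have h0 : T R₁ R₂ R₁ = 0 := by simp [T]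
    rw [ContinuousAt, h0] at hc
    exact hc.mono_left nhdsWithin_le_nhds
  have hN : normSqS R₁ σ₀ σ₁ 0 ≠ 0 := by
    unfold normSqS
    positivity
  have hdec : ContinuousAt (fun t₀ => Real.exp (-(2 * decay k R₁ σ₀ σ₁ t₀ (T R₁ R₂ r)))) 0 := by
    unfold decay
    have hNc : ContinuousAt (normSqS R₁ σ₀ σ₁) 0 := by
      unfold normSqS
      fun_prop
    have : ContinuousAt (fun t₀ => σ₀ ^ 2 * t₀ ^ 2 / normSqS R₁ σ₀ σ₁ t₀) 0 :=
      ContinuousAt.div (by fun_prop) hNc hN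
    fun_prop
  have hul : Tendsto u (𝓝[>] R₁) (𝓝 (u R₁)) := by
    have := hu R₁ ⟨le_rfl, hR⟩
    refine Tendsto.mono_left this ?_
    rw [← nhdsWithin_Ioo_eq_nhdsGT hR]
    exact nhdsWithin_mono _ Ioo_subset_Ico_self
  refine ge_of_tendsto ((hdec.tendsto.comp hT).mul (hul.norm.pow 2)) ?_
  filter_upwards [Ioo_mem_nhdsGT hr.1] with r₀ hr₀
  exact h1 r₀ hr₀

end Layer

/-! ### Functions `G(r) e^{imθ}` -/

/-- The function `G(r) e^{imθ}`. -/
noncomputable def polarMode (G : ℝ → ℂ) (m : ℤ) (z : ℂ) : ℂ := G ‖z‖ * (z / ‖z‖) ^ m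

/-- The open annulus. -/
def annulus (a b : ℝ) : Set ℂ := {z | ‖z‖ ∈ Ioo a b}

lemma isOpen_annulus (a b : ℝ) : IsOpen (annulus a b) := isOpen_Ioo.preimage continuous_norm

lemma hasDerivAt_line_norm {z : ℂ} (hz : z ≠ 0) (v : ℂ) :
    HasDerivAt (fun t : ℝ => ‖z + t * v‖) ((z.re * v.re + z.im * v.im) / ‖z‖) 0 := by
  have h1 : HasDerivAt (fun t : ℝ => z + t * v) v 0 := by
    have := ((hasDerivAt_id' (0 : ℝ)).ofReal_comp.mul_const v).const_add z
    simpa using this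
  have h2 := h1.norm_sq.sqrt (by simpa using hz)
  have e : (fun t : ℝ => ‖z + t * v‖) = fun t : ℝ => Real.sqrt (‖z + t * v‖ ^ 2) := by
    funext t
    rw [Real.sqrt_sq (norm_nonneg _)]
  rw [e]
  refine h2.congr_deriv ?_
  rw [Real.sqrt_sq (norm_nonneg _)]
  have hz' : ‖z‖ ≠ 0 := norm_ne_zero_iff.2 hz
  have : inner ℝ z v = z.re * v.re + z.im * v.im := by
    rw [Complex.inner]
    simp
    ring
  simp only [Complex.ofReal_zero, zero_mul, add_zero, this]
  field_simp

/-- The identity z̄v = z·v + i z×v separates the radial rate (z·v)/|z| from the angular rate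
(z×v)/|z|², and the latter acts on the phase as multiplication by i. -/
lemma hasDerivAt_line_polarMode {G : ℝ → ℂ} {G' : ℂ} {z : ℂ} (hz : z ≠ 0)
    (hG : HasDerivAt G G' ‖z‖) (m : ℤ) (v : ℂ) :
    HasDerivAt (fun t : ℝ => polarMode G m (z + t * v))
      ((G' * ((z.re * v.re + z.im * v.im) / ‖z‖ : ℝ)
        + G ‖z‖ * m * Complex.I * ((z.re * v.im - z.im * v.re) / ‖z‖ ^ 2 : ℝ)) * (z / ‖z‖) ^ m)
      0 := by
  have hz' : (‖z‖ : ℂ) ≠ 0 := by exact_mod_cast norm_ne_zero_iff.2 hz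
  have hn := hasDerivAt_line_norm hz v
  have h1 : HasDerivAt (fun t : ℝ => z + t * v) v 0 := by
    have := ((hasDerivAt_id' (0 : ℝ)).ofReal_comp.mul_const v).const_add z
    simpa using this
  have e0 : z + ((0 : ℝ) : ℂ) * v = z := by simp
  have hq := h1.fun_div hn.ofReal_comp (by rw [e0]; exact hz')
  have hG1 : HasDerivAt (fun t : ℝ => G ‖z + t * v‖)
      (((z.re * v.re + z.im * v.im) / ‖z‖ : ℝ) • G') 0 := by
    refine HasDerivAt.scomp (h := fun t : ℝ => ‖z + t * v‖) 0 ?_ hn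
    rw [e0]
    exact hG
  have hz0 : z / ‖z‖ ≠ 0 := div_ne_zero hz hz'
  have hp : HasDerivAt (fun t : ℝ => ((z + t * v) / (‖z + t * v‖ : ℂ)) ^ m) _ 0 :=
    HasDerivAt.comp (h := fun t : ℝ => (z + t * v) / (‖z + t * v‖ : ℂ)) 0
    (hasDerivAt_zpow m _ (Or.inl (by rw [e0]; exact hz0))) hq
  refine (hG1.fun_mul hp).congr_deriv ?_
  simp only [e0, Complex.real_smul, zpow_sub_one₀ hz0]
  have key : (‖z‖ : ℂ) ^ 2 = z * starRingEnd ℂ z := by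
    rw [Complex.mul_conj, ← Complex.sq_norm]; push_cast; rfl
  have k2 : ((z.re * v.re + z.im * v.im : ℝ) : ℂ)
      + Complex.I * ((z.re * v.im - z.im * v.re : ℝ) : ℂ) = starRingEnd ℂ z * v := by
    apply Complex.ext
    · simp
    · simp
      ring
  have hz1 : (z / ‖z‖)⁻¹ * ((v * ‖z‖ - z * (((z.re * v.re + z.im * v.im) / ‖z‖ : ℝ) : ℂ)) / ‖z‖ ^ 2)
      = Complex.I * ((z.re * v.im - z.im * v.re) / ‖z‖ ^ 2 : ℝ) := by
    rw [Complex.ofReal_div, Complex.ofReal_div, Complex.ofReal_pow, inv_div]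
    field_simp
    push_cast at k2 ⊢
    linear_combination v * key - z * k2
  simp only [Complex.ofReal_div] at hz1 ⊢
  linear_combination G ‖z‖ * m * (z / ‖z‖) ^ m * hz1

lemma tsupport_polarMode_subset (G : ℝ → ℂ) (m : ℤ) :
    tsupport (polarMode G m) ⊆ {z | ‖z‖ ∈ tsupport G} := by
  refine closure_minimal (fun z hz => subset_closure fun h => hz ?_)
    ((isClosed_tsupport G).preimage continuous_norm)
  rw [polarMode, h, zero_mul]

lemma contDiffAt_polarMode {G : ℝ → ℂ} {z : ℂ} (hz : z ≠ 0) (hG : ContDiffAt ℝ ∞ G ‖z‖) (m : ℤ) :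
    ContDiffAt ℝ ∞ (polarMode G m) z := by
  have hz' : (‖z‖ : ℂ) ≠ 0 := by exact_mod_cast norm_ne_zero_iff.2 hz
  have hn : ContDiffAt ℝ ∞ (fun z : ℂ => ‖z‖) z := contDiffAt_norm ℝ hz
  have hn' : ContDiffAt ℝ ∞ (fun z : ℂ => ((‖z‖ : ℝ) : ℂ)) z :=
    Complex.ofRealCLM.contDiff.contDiffAt.comp z hn
  have hq : ContDiffAt ℝ ∞ (fun z : ℂ => z / ‖z‖) z := by
    simp only [div_eq_mul_inv]
    exact contDiffAt_id.mul (hn'.inv hz')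
  have hp : ContDiffAt ℝ ∞ (fun w : ℂ => w ^ m) (z / ‖z‖) :=
    ((analyticAt_id.zpow (div_ne_zero hz hz')).contDiffAt (𝕜 := ℂ)).restrict_scalars ℝ
  exact (ContDiffAt.comp z hG hn).mul (ContDiffAt.comp (g := fun w : ℂ => w ^ m) z hp hq)

/-- The origin, the only point where modulus and phase fail to be smooth, lies off the support
because a ≥ 0. -/
lemma IsTest.polarMode {a b : ℝ} (ha : 0 ≤ a) {G : ℝ → ℂ} (hG : IsTest (Ioo a b) G) (m : ℤ) :
    IsTest (annulus a b) (polarMode G m) := by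
  have hsub : tsupport (PAL.polarMode G m) ⊆ annulus a b := fun z hz =>
    hG.subset (tsupport_polarMode_subset G m hz)
  refine ⟨contDiff_of_contDiffAt_tsupport fun z hz => ?_, ?_, hsub⟩
  · refine contDiffAt_polarMode (fun h => ?_) hG.contDiff.contDiffAt m
    have := (hsub hz).1
    rw [h, norm_zero] at this
    linarith
  · refine (isCompact_closedBall (0 : ℂ) b).of_isClosed_subset (isClosed_tsupport _) fun z hz => ?_
    rw [mem_closedBall_zero_iff]
    exact (hsub hz).2.le

lemma fderiv_polarMode {a b : ℝ} (ha : 0 ≤ a) {G : ℝ → ℂ} (hG : IsTest (Ioo a b) G) (m : ℤ)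
    {z : ℂ} (hz : z ≠ 0) (v : ℂ) :
    fderiv ℝ (polarMode G m) z v = (deriv G ‖z‖ * ((z.re * v.re + z.im * v.im) / ‖z‖ : ℝ)
        + G ‖z‖ * m * Complex.I * ((z.re * v.im - z.im * v.re) / ‖z‖ ^ 2 : ℝ))
        * (z / ‖z‖) ^ m := by
  have hd : DifferentiableAt ℝ (polarMode G m) z :=
    (hG.polarMode ha m).contDiff.differentiable (by simp) z
  rw [← hd.lineDeriv_eq_fderiv, lineDeriv]
  simp only [Complex.real_smul]
  exact (hasDerivAt_line_polarMode hz (hG.hasDerivAt _) m v).deriv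

section Fields
variable {a b : ℝ} {G G₁ G₂ : ℝ → ℂ}

lemma ofReal_norm_sq_eq (z : ℂ) : (‖z‖ : ℂ) ^ 2 = (z.re : ℂ) ^ 2 + (z.im : ℂ) ^ 2 := by
  have h : ‖z‖ ^ 2 = z.re ^ 2 + z.im ^ 2 := by
    rw [Complex.sq_norm, Complex.normSq_apply]
    ring
  exact_mod_cast h

lemma radial_fderiv_polarMode (ha : 0 ≤ a) (hG : IsTest (Ioo a b) G) (m : ℤ) {z : ℂ}
    (hz : z ≠ 0) :
    radial z (fderiv ℝ (polarMode G m) z 1) (fderiv ℝ (polarMode G m) z Complex.I)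
      = deriv G ‖z‖ * (z / ‖z‖) ^ m := by
  have hz' : (‖z‖ : ℂ) ≠ 0 := by exact_mod_cast norm_ne_zero_iff.2 hz
  rw [radial, fderiv_polarMode ha hG m hz, fderiv_polarMode ha hG m hz]
  simp only [Complex.one_re, Complex.one_im, Complex.I_re, Complex.I_im, mul_one, mul_zero,
    add_zero, zero_add, sub_zero, zero_sub]
  generalize (z / (‖z‖ : ℂ)) ^ m = e
  push_cast
  field_simp
  linear_combination (-(deriv G ‖z‖)) * ‖z‖ * e * ofReal_norm_sq_eq z

lemma angular_fderiv_polarMode (ha : 0 ≤ a) (hG : IsTest (Ioo a b) G) (m : ℤ) {z : ℂ}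
    (hz : z ≠ 0) :
    angular z (fderiv ℝ (polarMode G m) z 1) (fderiv ℝ (polarMode G m) z Complex.I)
      = Complex.I * m / ‖z‖ * G ‖z‖ * (z / ‖z‖) ^ m := by
  have hz' : (‖z‖ : ℂ) ≠ 0 := by exact_mod_cast norm_ne_zero_iff.2 hz
  rw [angular, fderiv_polarMode ha hG m hz, fderiv_polarMode ha hG m hz]
  simp only [Complex.one_re, Complex.one_im, Complex.I_re, Complex.I_im, mul_one, mul_zero,
    add_zero, zero_add, sub_zero, zero_sub]
  generalize (z / (‖z‖ : ℂ)) ^ m = e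
  push_cast
  field_simp
  linear_combination (-(Complex.I * m * G ‖z‖)) * e * ofReal_norm_sq_eq z

/-- The first Cartesian component of the vector field `(G₁ r̂ + G₂ θ̂) e^{inθ}`. -/
noncomputable def fieldX (G₁ G₂ : ℝ → ℂ) (n : ℤ) (z : ℂ) : ℂ :=
  1 / 2 * polarMode (fun r => G₁ r + Complex.I * G₂ r) (n + 1) z
    + 1 / 2 * polarMode (fun r => G₁ r - Complex.I * G₂ r) (n - 1) z

/-- The second Cartesian component of the vector field `(G₁ r̂ + G₂ θ̂) e^{inθ}`. -/
noncomputable def fieldY (G₁ G₂ : ℝ → ℂ) (n : ℤ) (z : ℂ) : ℂ :=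
  -(Complex.I / 2) * polarMode (fun r => G₁ r + Complex.I * G₂ r) (n + 1) z
    + Complex.I / 2 * polarMode (fun r => G₁ r - Complex.I * G₂ r) (n - 1) z

/-- In Cartesian components the frame r̂, θ̂ is a combination of e^{iθ} and e^{-iθ}. The components
of the field are thus sums of modes n ± 1, admissible as test functions for the weak derivatives in
x and y. -/
lemma isTest_fieldX (ha : 0 ≤ a) (h₁ : IsTest (Ioo a b) G₁) (h₂ : IsTest (Ioo a b) G₂) (n : ℤ) :
    IsTest (annulus a b) (fieldX G₁ G₂ n) :=
  (((h₁.add (h₂.const_mul _)).polarMode ha _).const_mul _).add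
    (((h₁.sub (h₂.const_mul _)).polarMode ha _).const_mul _)

lemma isTest_fieldY (ha : 0 ≤ a) (h₁ : IsTest (Ioo a b) G₁) (h₂ : IsTest (Ioo a b) G₂) (n : ℤ) :
    IsTest (annulus a b) (fieldY G₁ G₂ n) :=
  (((h₁.add (h₂.const_mul _)).polarMode ha _).const_mul _).add
    (((h₁.sub (h₂.const_mul _)).polarMode ha _).const_mul _)

lemma inv_div_norm {z : ℂ} (hz : z ≠ 0) : (z / ‖z‖)⁻¹ = starRingEnd ℂ z / ‖z‖ := by
  have hz' : (‖z‖ : ℂ) ≠ 0 := by exact_mod_cast norm_ne_zero_iff.2 hz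
  have key : (‖z‖ : ℂ) ^ 2 = z * starRingEnd ℂ z := by
    rw [Complex.mul_conj, ← Complex.sq_norm]; push_cast; rfl
  rw [inv_div]
  field_simp
  linear_combination key

lemma fieldX_eq {z : ℂ} (hz : z ≠ 0) (n : ℤ) :
    fieldX G₁ G₂ n z = (G₁ ‖z‖ * (z.re / ‖z‖) - G₂ ‖z‖ * (z.im / ‖z‖)) * (z / ‖z‖) ^ n := by
  have hz' : (‖z‖ : ℂ) ≠ 0 := by exact_mod_cast norm_ne_zero_iff.2 hz
  have hz0 := div_ne_zero hz hz'
  have hc : starRingEnd ℂ z = z.re - z.im * Complex.I := by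
    apply Complex.ext <;> simp
  simp only [fieldX, polarMode, zpow_add_one₀ hz0, zpow_sub_one₀ hz0, inv_div_norm hz, hc]
  generalize (z / (‖z‖ : ℂ)) ^ n = e
  nth_rw 3 [← Complex.re_add_im z]
  ring_nf
  simp only [Complex.I_sq]
  ring

lemma fieldY_eq {z : ℂ} (hz : z ≠ 0) (n : ℤ) :
    fieldY G₁ G₂ n z = (G₁ ‖z‖ * (z.im / ‖z‖) + G₂ ‖z‖ * (z.re / ‖z‖)) * (z / ‖z‖) ^ n := by
  have hz' : (‖z‖ : ℂ) ≠ 0 := by exact_mod_cast norm_ne_zero_iff.2 hz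
  have hz0 := div_ne_zero hz hz'
  have hc : starRingEnd ℂ z = z.re - z.im * Complex.I := by
    apply Complex.ext <;> simp
  simp only [fieldY, polarMode, zpow_add_one₀ hz0, zpow_sub_one₀ hz0, inv_div_norm hz, hc]
  generalize (z / (‖z‖ : ℂ)) ^ n = e
  nth_rw 3 [← Complex.re_add_im z]
  ring_nf
  simp only [Complex.I_sq]
  ring

/-- The divergence in polar coordinates. -/
lemma divergence_field (ha : 0 ≤ a) (h₁ : IsTest (Ioo a b) G₁) (h₂ : IsTest (Ioo a b) G₂) (n : ℤ)
    {z : ℂ} (hz : z ≠ 0) :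
    fderiv ℝ (fieldX G₁ G₂ n) z 1 + fderiv ℝ (fieldY G₁ G₂ n) z Complex.I
      = (deriv G₁ ‖z‖ + G₁ ‖z‖ / ‖z‖ + Complex.I * n / ‖z‖ * G₂ ‖z‖) * (z / ‖z‖) ^ n := by
  have hz' : (‖z‖ : ℂ) ≠ 0 := by exact_mod_cast norm_ne_zero_iff.2 hz
  have hz0 := div_ne_zero hz hz'
  have hc : starRingEnd ℂ z = z.re - z.im * Complex.I := by
    apply Complex.ext <;> simp
  have tA := h₁.add (h₂.const_mul Complex.I)
  have tB := h₁.sub (h₂.const_mul Complex.I)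
  have dA := (((tA.polarMode ha (n + 1)).contDiff.differentiable (by simp)) z).hasFDerivAt
  have dB := (((tB.polarMode ha (n - 1)).contDiff.differentiable (by simp)) z).hasFDerivAt
  have eX : fderiv ℝ (fieldX G₁ G₂ n) z = _ :=
    ((dA.const_mul (1 / 2)).fun_add (dB.const_mul (1 / 2))).fderiv
  have eY : fderiv ℝ (fieldY G₁ G₂ n) z = _ :=
    ((dA.const_mul (-(Complex.I / 2))).fun_add (dB.const_mul (Complex.I / 2))).fderiv
  have deA : deriv (fun r => G₁ r + Complex.I * G₂ r) ‖z‖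
      = deriv G₁ ‖z‖ + Complex.I * deriv G₂ ‖z‖ :=
    ((h₁.hasDerivAt _).fun_add ((h₂.hasDerivAt _).const_mul _)).deriv
  have deB : deriv (fun r => G₁ r - Complex.I * G₂ r) ‖z‖
      = deriv G₁ ‖z‖ - Complex.I * deriv G₂ ‖z‖ :=
    ((h₁.hasDerivAt _).fun_sub ((h₂.hasDerivAt _).const_mul _)).deriv
  rw [eX, eY]
  simp only [add_apply, smul_apply, smul_eq_mul,
    fderiv_polarMode ha tA _ hz, fderiv_polarMode ha tB _ hz, deA, deB, zpow_add_one₀ hz0,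
    zpow_sub_one₀ hz0, inv_div_norm hz, hc, Complex.one_re, Complex.one_im, Complex.I_re,
    Complex.I_im, mul_one, mul_zero, add_zero, zero_add, sub_zero, zero_sub]
  generalize (z / (‖z‖ : ℂ)) ^ n = e
  have hε : (z.re + z.im * Complex.I) / ‖z‖ * ((z.re - z.im * Complex.I) / ‖z‖) = 1 := by
    field_simp
    linear_combination -(ofReal_norm_sq_eq z) - z.im ^ 2 * Complex.I_sq
  have hzz : z / (‖z‖ : ℂ) = (z.re + z.im * Complex.I) / ‖z‖ := by rw [Complex.re_add_im]
  rw [hzz]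
  push_cast
  linear_combination (1 / 2 * e * (deriv G₁ ‖z‖ + Complex.I * deriv G₂ ‖z‖
    + (n + 1) * (G₁ ‖z‖ + Complex.I * G₂ ‖z‖) / ‖z‖
    + (deriv G₁ ‖z‖ - Complex.I * deriv G₂ ‖z‖)
    - (n - 1) * (G₁ ‖z‖ - Complex.I * G₂ ‖z‖) / ‖z‖)) * hε
    + (-(1 / 2 * e * ((z.re + z.im * Complex.I) / ‖z‖) * (n + 1)
      * (G₁ ‖z‖ + Complex.I * G₂ ‖z‖) * (z.re / ‖z‖ ^ 2))
    + 1 / 2 * e * ((z.re - z.im * Complex.I) / ‖z‖) * (n - 1)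
      * (G₁ ‖z‖ - Complex.I * G₂ ‖z‖) * (z.re / ‖z‖ ^ 2)) * Complex.I_sq

end Fields

/-! ### The angular modes -/

/-- The angular mode `∫₀^{2π} U(r e^{iθ}) e^{inθ} dθ`. -/
noncomputable def mode (U : ℂ → ℂ) (n : ℤ) (r : ℝ) : ℂ :=
  ∫ θ in (0 : ℝ)..(2 * Real.pi), U (circleMap 0 r θ) * Complex.exp (n * θ * Complex.I)

/-- Periodicity moves the interval to (-π, π), the angular range of polar coordinates. -/
lemma mode_eq_setIntegral (U : ℂ → ℂ) (n : ℤ) (r : ℝ) :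
    mode U n r = ∫ θ in Ioo (-Real.pi) Real.pi,
      U (circleMap 0 r θ) * Complex.exp (n * θ * Complex.I) := by
  have hp : Function.Periodic
      (fun θ : ℝ => U (circleMap 0 r θ) * Complex.exp (n * θ * Complex.I)) (2 * Real.pi) := by
    intro θ
    have h1 := periodic_circleMap 0 r θ
    have h2 : Complex.exp (n * ((θ + 2 * Real.pi : ℝ) : ℂ) * Complex.I)
        = Complex.exp (n * θ * Complex.I) := by
      rw [Complex.exp_eq_exp_iff_exists_int]
      refine ⟨n, ?_⟩
      push_cast
      ring
    simp only [h1, h2]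
  have h := hp.intervalIntegral_add_eq 0 (-Real.pi)
  rw [mode, ← zero_add (2 * Real.pi), h, intervalIntegral.integral_of_le (by
    linarith [Real.pi_pos]), integral_Ioc_eq_integral_Ioo]
  congr 3
  ring

lemma polarMode_circleMap (H : ℝ → ℂ) (n : ℤ) {r : ℝ} (hr : 0 < r) (θ : ℝ) :
    polarMode H n (circleMap 0 r θ) = H r * Complex.exp (n * θ * Complex.I) := by
  have h1 : ‖circleMap 0 r θ‖ = r := by rw [norm_circleMap_zero, abs_of_pos hr]
  have h2 : (r : ℂ) ≠ 0 := by exact_mod_cast hr.ne'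
  rw [polarMode, h1, circleMap, zero_add, mul_div_cancel_left₀ _ h2, ← Complex.exp_int_mul,
    mul_assoc]

lemma integral_mul_polarMode {a b : ℝ} (ha : 0 ≤ a) {U : ℂ → ℂ} (hU : ContinuousOn U (annulus a b))
    {H : ℝ → ℂ} (hH : IsTest (Ioo a b) H) (n : ℤ) :
    ∫ z, U z * polarMode H n z = ∫ r, mode U n r * (r * H r) := by
  have tF := hH.polarMode ha n
  have cF : Continuous fun z => U z * polarMode H n z :=
    tF.continuous_mul (isOpen_annulus a b) hU
  set F : ℝ × ℝ → ℂ := fun p => p.1 • (fun z => U z * polarMode H n z) (circleMap 0 p.1 p.2) with hF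
  have cFc : Continuous F := by
    have h1 : Continuous fun p : ℝ × ℝ => circleMap 0 p.1 p.2 := by
      unfold circleMap
      fun_prop
    exact continuous_fst.smul (cF.comp h1)
  -- The strip is unbounded in the radius, but F is continuous and vanishes for radii beyond b.
  have hI : IntegrableOn F (Ioi (0 : ℝ) ×ˢ Ioo (-Real.pi) Real.pi) := by
    have h1 : IntegrableOn F (Icc (0 : ℝ) b ×ˢ Icc (-Real.pi) Real.pi) :=
      cFc.continuousOn.integrableOn_compact (isCompact_Icc.prod isCompact_Icc)
    refine h1.of_forall_sdiff_eq_zero (measurableSet_Ioi.prod measurableSet_Ioo) fun p hp => ?_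
    have hp1 : 0 < p.1 := hp.1.1
    have hb : b < p.1 := by
      by_contra hc
      exact hp.2 ⟨⟨hp1.le, not_lt.1 hc⟩, Ioo_subset_Icc_self hp.1.2⟩
    have h0 : H p.1 = 0 := hH.apply_eq_zero fun h => absurd h.2 (not_lt.2 hb.le)
    simp only [hF, polarMode_circleMap H n hp1, h0, zero_mul, mul_zero, smul_zero]
  rw [← Complex.integral_comp_polarCoord_symm]
  have e1 : ∀ p : ℝ × ℝ, p.1 • (fun z => U z * polarMode H n z) (Complex.polarCoord.symm p)
      = F p := fun p => by
    have : Complex.polarCoord.symm p = circleMap 0 p.1 p.2 := by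
      rw [Complex.polarCoord_symm_apply, circleMap, zero_add, Complex.exp_mul_I,
        Complex.ofReal_cos, Complex.ofReal_sin]
    rw [hF, this]
  simp_rw [e1]
  rw [polarCoord_target, Measure.volume_eq_prod, setIntegral_prod _ hI,
    ← setIntegral_eq_integral_of_forall_compl_eq_zero (s := Ioi (0 : ℝ))
      (f := fun r => mode U n r * (r * H r))]
  · refine setIntegral_congr_fun measurableSet_Ioi fun r hr => ?_
    simp only [hF, polarMode_circleMap H n (mem_Ioi.1 hr), mode_eq_setIntegral, Complex.real_smul]
    rw [← integral_mul_const]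
    refine integral_congr_ae (ae_of_all _ fun θ => ?_)
    simp only
    ring
  · intro r hr
    rw [hH.apply_eq_zero fun h => hr (ha.trans_lt h.1), mul_zero, mul_zero]

lemma IsTest.integrable_mul_of_memLp {Ω : Set ℂ} {u X : ℂ → ℂ}
    (hu : MemLp u 2 (volume.restrict Ω)) (hX : IsTest Ω X) :
    Integrable fun z => u z * X z := by
  have h1 : MemLp X 2 (volume.restrict Ω) :=
    hX.contDiff.continuous.memLp_of_hasCompactSupport hX.compact
  have h2 : IntegrableOn (fun z => u z * X z) Ω := hu.integrable_mul h1
  rwa [integrableOn_iff_integrable_of_support_subset] at h2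
  intro z hz
  by_contra hc
  exact hz (by simp only [hX.apply_eq_zero hc, mul_zero])

lemma IsTest.mono {Ω Ω' : Set ℂ} (h : Ω ⊆ Ω') {X : ℂ → ℂ} (hX : IsTest Ω X) : IsTest Ω' X :=
  ⟨hX.contDiff, hX.compact, hX.subset.trans h⟩

lemma IsTest.isTestFunction {Ω : Set ℂ} {X : ℂ → ℂ} (hX : IsTest Ω X) : IsTestFunction Ω X :=
  ⟨hX.contDiff, hX.compact, hX.subset⟩

lemma IsWeakDeriv.integral_eq {Ω : Set ℂ} {v : ℂ} {u u' X : ℂ → ℂ} (h : IsWeakDeriv Ω v u u')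
    (hX : IsTest Ω X) : ∫ z, u' z * X z = -∫ z, u z * fderiv ℝ X z v := by
  have h1 := h X hX.isTestFunction
  rw [setIntegral_eq_integral_of_forall_compl_eq_zero fun z hz => by
      rw [(hX.fderiv_apply v).apply_eq_zero hz, mul_zero],
    setIntegral_eq_integral_of_forall_compl_eq_zero fun z hz => by
      rw [hX.apply_eq_zero hz, mul_zero]] at h1
  rw [h1, neg_neg]

lemma annulus_subset {R₁ ρ R : ℝ} {D : Set ℂ} (hD : closure D ⊆ Metric.ball 0 R₁) (hρ : ρ ≤ R) :
    annulus R₁ ρ ⊆ Metric.ball 0 R \ closure D := fun z hz => by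
  refine ⟨mem_ball_zero_iff.2 (hz.2.trans_le hρ), fun h => ?_⟩
  exact absurd hz.1 (not_lt.2 (mem_ball_zero_iff.1 (hD h)).le)

/-- Each angular mode of a solution solves the radial equation in the layer. -/
theorem IsSolution.isVeryWeakRadialSolution {k R₁ R₂ σ₀ σ₁ : ℝ} (hR₁ : 0 < R₁) (hR : R₁ < R₂)
    (hσ₀ : 0 < σ₀) {D : Set ℂ} (hD : closure D ⊆ Metric.ball 0 R₁) {f G U : ℂ → ℂ}
    (hfsupp : ∀ᵐ z : ℂ, R₁ < ‖z‖ → f z = 0) (hU : IsSolution k R₁ R₂ σ₀ σ₁ D f G U) (n : ℤ) :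
    IsVeryWeakRadialSolution k R₁ R₂ σ₀ σ₁ n (mode U n) := by
  intro ψ hψ₀
  obtain ⟨Ux, Uy, hH1, hweak⟩ := hU.equation
  obtain ⟨a', b', -, hb', hK⟩ := exists_Icc_of_isCompact_subset_Ioo hR hψ₀.compact hψ₀.subset
  -- `U` is known to be H¹ only on balls of radius less than R₂, so ρ is taken between the support
  -- of ψ and R₂.
  obtain ⟨ρ, hρ1, hρ⟩ := exists_between (max_lt hb' hR)
  have hψ : IsTest (Ioo R₁ ρ) ψ := ⟨hψ₀.contDiff, hψ₀.compact, fun r hr =>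
    ⟨(hψ₀.subset hr).1, (hK hr).2.trans_lt ((le_max_left _ _).trans_lt hρ1)⟩⟩
  have hsubR : Ioo R₁ ρ ⊆ Ioo R₁ R₂ := Ioo_subset_Ioo_right hρ.le
  have hInv : ContDiffOn ℝ ∞ (fun r : ℝ => ((r : ℝ) : ℂ)⁻¹) (Ioo R₁ ρ) :=
    Complex.ofRealCLM.contDiff.contDiffOn.inv fun r hr => by
      simpa using (hR₁.trans hr.1).ne'
  have hSα : ContDiffOn ℝ ∞ (fun r => S R₁ R₂ σ₀ σ₁ r / α R₁ R₂ σ₀ σ₁ r) (Ioo R₁ ρ) :=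
    (contDiffOn_S_div_α hσ₀).mono hsubR
  have hαd : ContDiffOn ℝ ∞ (α R₁ R₂ σ₀ σ₁) (Ioo R₁ ρ) := contDiffOn_α.mono hsubR
  have hSd : ContDiffOn ℝ ∞ (S R₁ R₂ σ₀ σ₁) (Ioo R₁ ρ) := contDiffOn_S.mono hsubR
  have hSi : ContDiffOn ℝ ∞ (fun r => (S R₁ R₂ σ₀ σ₁ r)⁻¹) (Ioo R₁ ρ) :=
    hSd.inv fun r hr => S_ne_zero hσ₀ (hsubR hr)
  -- The gradient of ψ e^{inθ} weighted by the coefficients of the equation is (G₁ r̂ + G₂ θ̂)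
  -- e^{inθ}: indeed G₁ = (β/α) ψ' and G₂ = (α/β)(in/r) ψ. The zero-order term is Q = αβk² ψ.
  set P : ℝ → ℂ := fun r => S R₁ R₂ σ₀ σ₁ r / α R₁ R₂ σ₀ σ₁ r * deriv ψ r with hP
  set G₁ : ℝ → ℂ := fun r => (r : ℂ)⁻¹ * P r with hG₁
  set G₂ : ℝ → ℂ := fun r => Complex.I * n * (α R₁ R₂ σ₀ σ₁ r * ((S R₁ R₂ σ₀ σ₁ r)⁻¹ * ψ r))
    with hG₂
  set Q : ℝ → ℂ := fun r => (k : ℂ) ^ 2 * ((r : ℂ)⁻¹ *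
    (α R₁ R₂ σ₀ σ₁ r * (S R₁ R₂ σ₀ σ₁ r * ψ r))) with hQ
  have tP : IsTest (Ioo R₁ ρ) P := hψ.deriv.mul isOpen_Ioo hSα
  have tG₁ : IsTest (Ioo R₁ ρ) G₁ := tP.mul isOpen_Ioo hInv
  have tG₂ : IsTest (Ioo R₁ ρ) G₂ :=
    ((hψ.mul isOpen_Ioo hSi).mul isOpen_Ioo hαd).const_mul _
  have tQ : IsTest (Ioo R₁ ρ) Q :=
    (((hψ.mul isOpen_Ioo hSd).mul isOpen_Ioo hαd).mul isOpen_Ioo hInv).const_mul _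
  have tφ := hψ.polarMode hR₁.le n
  have tX := isTest_fieldX hR₁.le tG₁ tG₂ n
  have tY := isTest_fieldY hR₁.le tG₁ tG₂ n
  have tΘ := tQ.polarMode hR₁.le n
  have hne : ∀ z ∈ annulus R₁ ρ, z ≠ 0 := fun z hz h => by
    have := hz.1
    rw [h, norm_zero] at this
    linarith
  have hΩ : annulus R₁ ρ ⊆ Metric.ball 0 ρ \ closure D := annulus_subset hD le_rfl
  have hΩ₂ : annulus R₁ ρ ⊆ Metric.ball 0 R₂ \ closure D := annulus_subset hD hρ.le
  obtain ⟨mU, mx, my, wx, wy⟩ := hH1 ρ hρ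
  have hpt : ∀ z, (-(β R₁ R₂ σ₀ σ₁ ‖z‖ / α R₁ R₂ σ₀ σ₁ ‖z‖ * radial z (Ux z) (Uy z)
          * radial z (fderiv ℝ (polarMode ψ n) z 1) (fderiv ℝ (polarMode ψ n) z Complex.I))
        - α R₁ R₂ σ₀ σ₁ ‖z‖ / β R₁ R₂ σ₀ σ₁ ‖z‖ * angular z (Ux z) (Uy z)
          * angular z (fderiv ℝ (polarMode ψ n) z 1) (fderiv ℝ (polarMode ψ n) z Complex.I)
        + α R₁ R₂ σ₀ σ₁ ‖z‖ * β R₁ R₂ σ₀ σ₁ ‖z‖ * (k : ℂ) ^ 2 * U z * polarMode ψ n z)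
      = -(Ux z * fieldX G₁ G₂ n z) - Uy z * fieldY G₁ G₂ n z + U z * polarMode Q n z := by
    intro z
    by_cases hz : z ∈ annulus R₁ ρ
    · have hα := α_ne_zero (σ₁ := σ₁) hσ₀ (hsubR hz)
      have hS := S_ne_zero (σ₁ := σ₁) hσ₀ (hsubR hz)
      have hz0 := hne z hz
      have hz' : (‖z‖ : ℂ) ≠ 0 := by exact_mod_cast norm_ne_zero_iff.2 hz0
      rw [radial_fderiv_polarMode hR₁.le hψ n hz0, angular_fderiv_polarMode hR₁.le hψ n hz0,
        fieldX_eq hz0, fieldY_eq hz0, polarMode, polarMode, radial, angular, β]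
      simp only [hG₁, hG₂, hQ, hP, Complex.ofReal_div]
      generalize (z / (‖z‖ : ℂ)) ^ n = e
      field_simp
      ring
    · rw [(tφ.fderiv_apply 1).apply_eq_zero hz, (tφ.fderiv_apply Complex.I).apply_eq_zero hz,
        tX.apply_eq_zero hz, tY.apply_eq_zero hz, tφ.apply_eq_zero hz, tΘ.apply_eq_zero hz]
      simp only [radial, angular]
      ring
  have hw := hweak _ (tφ.mono hΩ₂).isTestFunction
  have hrhs : ∫ z in Metric.ball 0 R₂ \ closure D, f z * polarMode ψ n z = 0 := by
    refine integral_eq_zero_of_ae ?_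
    filter_upwards [ae_restrict_of_ae hfsupp] with z hz
    by_cases h : z ∈ annulus R₁ ρ
    · rw [hz h.1, zero_mul, Pi.zero_apply]
    · rw [tφ.apply_eq_zero h, mul_zero, Pi.zero_apply]
  rw [hrhs] at hw
  simp_rw [hpt] at hw
  rw [setIntegral_eq_integral_of_forall_compl_eq_zero fun z hz => by
    have h : z ∉ annulus R₁ ρ := fun h => hz (hΩ₂ h)
    rw [tX.apply_eq_zero h, tY.apply_eq_zero h, tΘ.apply_eq_zero h]
    ring] at hw
  have i1 := (tX.mono hΩ).integrable_mul_of_memLp mx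
  have i1' : Integrable fun z => -(Ux z * fieldX G₁ G₂ n z) := i1.neg
  have i2 := (tY.mono hΩ).integrable_mul_of_memLp my
  have i3 := (tΘ.mono hΩ).integrable_mul_of_memLp mU
  have i4 := ((tX.fderiv_apply 1).mono hΩ).integrable_mul_of_memLp mU
  have i5 := ((tY.fderiv_apply Complex.I).mono hΩ).integrable_mul_of_memLp mU
  have i45 : Integrable fun z => U z * fderiv ℝ (fieldX G₁ G₂ n) z 1
      + U z * fderiv ℝ (fieldY G₁ G₂ n) z Complex.I := i4.add i5
  rw [integral_add (i1'.sub' i2) i3, integral_sub i1' i2, integral_neg,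
    wx.integral_eq (tX.mono hΩ), wy.integral_eq (tY.mono hΩ), neg_neg, sub_neg_eq_add,
    ← integral_add i4 i5, ← integral_add i45 i3] at hw
  -- H is the radial profile of the divergence of the field plus Q. With the polar area factor, r H
  -- = (r G₁)' + in G₂ + r Q = P' + α(k²S - n²/S) ψ, the radial operator applied to ψ.
  set H : ℝ → ℂ := fun r => deriv G₁ r + (r : ℂ)⁻¹ * G₁ r
    + Complex.I * n * ((r : ℂ)⁻¹ * G₂ r) + Q r with hHdef
  have tH : IsTest (Ioo R₁ ρ) H :=
    ((tG₁.deriv.add (tG₁.mul isOpen_Ioo hInv)).add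
      ((tG₂.mul isOpen_Ioo hInv).const_mul _)).add tQ
  have hpt2 : ∀ z, U z * fderiv ℝ (fieldX G₁ G₂ n) z 1
      + U z * fderiv ℝ (fieldY G₁ G₂ n) z Complex.I + U z * polarMode Q n z
      = U z * polarMode H n z := by
    intro z
    by_cases hz : z ∈ annulus R₁ ρ
    · rw [← mul_add, divergence_field hR₁.le tG₁ tG₂ n (hne z hz), polarMode, polarMode, hHdef]
      ring
    · rw [(tX.fderiv_apply 1).apply_eq_zero hz, (tY.fderiv_apply Complex.I).apply_eq_zero hz,
        tΘ.apply_eq_zero hz, (tH.polarMode hR₁.le n).apply_eq_zero hz]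
      ring
  simp_rw [hpt2] at hw
  rw [integral_mul_polarMode hR₁.le (hU.continuousOn.mono fun z hz =>
    ⟨hz.1.le, hz.2.trans hρ⟩) tH n] at hw
  rw [← hw]
  refine integral_congr_ae (ae_of_all _ fun r => ?_)
  simp only
  congr 1
  by_cases hr : r ∈ Ioo R₁ ρ
  · have hS := S_ne_zero (σ₁ := σ₁) hσ₀ (hsubR hr)
    have hr0 : (r : ℂ) ≠ 0 := by exact_mod_cast (hR₁.trans hr.1).ne'
    have e1 : P =ᶠ[𝓝 r] fun r => (r : ℂ) * G₁ r := by
      filter_upwards [isOpen_Ioo.mem_nhds hr] with y hy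
      have hy0 : (y : ℂ) ≠ 0 := by exact_mod_cast (hR₁.trans hy.1).ne'
      rw [hG₁, mul_inv_cancel_left₀ hy0]
    have e2 := ((hasDerivAt_id' r).ofReal_comp.fun_mul (tG₁.hasDerivAt r)).deriv
    have e3 : deriv P r = G₁ r + r * deriv G₁ r := by
      rw [e1.deriv_eq, e2]
      simp
    rw [e3]
    simp only [hHdef, hG₂, hQ]
    push_cast
    field_simp
    linear_combination (-(α R₁ R₂ σ₀ σ₁ r * n ^ 2 * ψ r)) * Complex.I_sq
  · rw [tP.deriv.apply_eq_zero hr, tH.apply_eq_zero hr, hψ.apply_eq_zero hr]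
    ring

/-! ### Continuity and boundedness of the modes, and Parseval's identity -/

lemma continuous_circle {R₁ R₂ : ℝ} (hR₁ : 0 < R₁) {U : ℂ → ℂ}
    (hU : ContinuousOn U {z : ℂ | R₁ ≤ ‖z‖ ∧ ‖z‖ < R₂}) {r : ℝ} (hr : r ∈ Ico R₁ R₂) :
    Continuous fun θ => U (circleMap 0 r θ) := by
  refine hU.comp_continuous (continuous_circleMap 0 r) fun θ => ?_
  rw [mem_ofPred_eq, norm_circleMap_zero, abs_of_pos (hR₁.trans_le hr.1)]
  exact hr

lemma continuousOn_mode {R₁ R₂ : ℝ} (hR₁ : 0 < R₁) {U : ℂ → ℂ}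
    (hU : ContinuousOn U {z : ℂ | R₁ ≤ ‖z‖ ∧ ‖z‖ < R₂}) (n : ℤ) :
    ContinuousOn (mode U n) (Ico R₁ R₂) := by
  intro r hr
  obtain ⟨R, hrR, hR⟩ := exists_between hr.2
  -- Clamping the radius to [R₁, R] gives an integrand continuous on all of ℝ × ℝ, which agrees with
  -- the original one for radii of the layer near r.
  have hclamp : Continuous fun s : ℝ => max R₁ (min s R) := by fun_prop
  have h1 : Continuous fun p : ℝ × ℝ => U (circleMap 0 (max R₁ (min p.1 R)) p.2) := by
    refine hU.comp_continuous ?_ fun p => ?_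
    · unfold circleMap
      fun_prop
    · rw [mem_ofPred_eq, norm_circleMap_zero, abs_of_pos (hR₁.trans_le (le_max_left _ _))]
      exact ⟨le_max_left _ _, max_lt (hr.1.trans_lt hr.2) ((min_le_right _ _).trans_lt hR)⟩
  have h2 : Continuous fun s : ℝ => ∫ θ in (0 : ℝ)..(2 * Real.pi),
      U (circleMap 0 (max R₁ (min s R)) θ) * Complex.exp (n * θ * Complex.I) := by
    refine intervalIntegral.continuous_parametric_intervalIntegral_of_continuous' ?_ _ _
    exact h1.mul (by fun_prop)
  refine (h2.continuousWithinAt (s := Ico R₁ R₂) (x := r)).congr_of_eventuallyEq ?_ ?_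
  · filter_upwards [self_mem_nhdsWithin, mem_nhdsWithin_of_mem_nhds (Iio_mem_nhds hrR)] with s h3 h4
    rw [min_eq_left (le_of_lt h4), max_eq_right h3.1, mode]
  · rw [min_eq_left hrR.le, max_eq_right hr.1, mode]

lemma norm_mode_le {U : ℂ → ℂ} {M r : ℝ} (hr : 0 < r) (hM : ∀ z : ℂ, ‖z‖ = r → ‖U z‖ ≤ M)
    (n : ℤ) : ‖mode U n r‖ ≤ M * |2 * Real.pi - 0| := by
  refine intervalIntegral.norm_integral_le_of_norm_le_const fun θ _ => ?_
  have h1 : ‖Complex.exp (n * θ * Complex.I)‖ = 1 := by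
    have := Complex.norm_exp_ofReal_mul_I (n * θ)
    push_cast at this
    exact this
  rw [norm_mul, h1, mul_one]
  exact hM _ (by rw [norm_circleMap_zero, abs_of_pos hr])

/-- Parseval's identity on a circle. -/
lemma hasSum_norm_sq_mode {U : ℂ → ℂ} {r : ℝ} (hU : Continuous fun θ => U (circleMap 0 r θ)) :
    HasSum (fun n : ℤ => (1 / (2 * Real.pi)) ^ 2 * ‖mode U (-n) r‖ ^ 2)
      ((2 * Real.pi)⁻¹ * circleEnergy U r) := by
  have hpi := Real.two_pi_pos
  have h := hasSum_sq_fourierCoeffOn hpi (f := fun θ => U (circleMap 0 r θ)) (by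
    obtain ⟨C, hC⟩ := isCompact_Icc.exists_bound_of_continuousOn
      (hU.continuousOn (s := Icc 0 (2 * Real.pi)))
    refine MemLp.of_bound hU.aestronglyMeasurable C ?_
    exact (ae_restrict_iff' measurableSet_Ioc).2
      (ae_of_all _ fun θ hθ => hC θ (Ioc_subset_Icc_self hθ)))
  rw [sub_zero, smul_eq_mul] at h
  refine h.congr_fun fun n => ?_
  -- Modes are integrals against e^{inθ}, Fourier coefficients against e^{-inθ}; hence the index -n.
  have e : fourierCoeffOn hpi (fun θ => U (circleMap 0 r θ)) n
      = ((1 / (2 * Real.pi) : ℝ) : ℂ) * mode U (-n) r := by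
    rw [fourierCoeffOn_eq_integral, sub_zero, Complex.real_smul, mode]
    congr 1
    refine intervalIntegral.integral_congr fun θ _ => ?_
    rw [fourier_coe_apply, smul_eq_mul, mul_comm]
    congr 2
    have : (Real.pi : ℂ) ≠ 0 := by exact_mod_cast Real.pi_ne_zero
    push_cast
    field_simp
  rw [e, norm_mul, mul_pow, Complex.norm_real, Real.norm_eq_abs, sq_abs]

/-! ### The decay exponent in terms of T and τ, and the summation over modes -/

lemma decay_zero_eq {k R₁ R₂ σ₀ σ₁ r : ℝ} (hk : 0 < k) (hR₁ : 0 < R₁) (hσ₀ : 0 < σ₀)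
    (hσ₁ : 0 < σ₁) (hr : r ∈ Ico R₁ R₂) :
    decay k R₁ σ₀ σ₁ 0 (T R₁ R₂ r) = k * σ₀ * T R₁ R₂ r
      * Real.sqrt (1 - R₁ ^ 2 / normSqS R₁ σ₀ σ₁ (T R₁ R₂ r)) := by
  have ht := T_nonneg hr
  have hN : normSqS R₁ σ₀ σ₁ (T R₁ R₂ r) ≠ 0 := by
    unfold normSqS
    positivity
  have h0 : normSqS R₁ σ₀ σ₁ 0 = R₁ ^ 2 := by simp [normSqS]
  -- At t₀ = 0 the second quotient is zero and the squared modulus of S is R₁², so with N = |S|² the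
  -- product is k²(N - R₁²) · σ₀²T²/N.
  have h1 : (k ^ 2 * normSqS R₁ σ₀ σ₁ (T R₁ R₂ r) - k ^ 2 * normSqS R₁ σ₀ σ₁ 0)
      * (σ₀ ^ 2 * T R₁ R₂ r ^ 2 / normSqS R₁ σ₀ σ₁ (T R₁ R₂ r)
        - σ₀ ^ 2 * 0 ^ 2 / normSqS R₁ σ₀ σ₁ 0)
      = (k * σ₀ * T R₁ R₂ r) ^ 2 * (1 - R₁ ^ 2 / normSqS R₁ σ₀ σ₁ (T R₁ R₂ r)) := by
    rw [h0]
    field_simp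
    ring
  rw [decay, h1, Real.sqrt_mul (sq_nonneg _), Real.sqrt_sq (by positivity)]

lemma τ_div_one_sub_τ {R₁ R₂ r : ℝ} (hr : r ∈ Ico R₁ R₂) :
    (R₂ - R₁) * (τ R₁ R₂ r / (1 - τ R₁ R₂ r)) = T R₁ R₂ r := by
  have h1 : R₂ - R₁ ≠ 0 := by linarith [hr.1, hr.2]
  have h2 : R₂ - r ≠ 0 := by linarith [hr.2]
  have h3 : 1 - τ R₁ R₂ r = (R₂ - r) / (R₂ - R₁) := by
    rw [τ]
    field_simp
    ring
  rw [h3, τ, T]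
  field_simp

lemma h_mul_one_sub_τ_sq {R₁ R₂ σ₀ σ₁ r : ℝ} (hr : r ∈ Ico R₁ R₂) :
    h R₁ R₂ σ₀ σ₁ (τ R₁ R₂ r) * (1 - τ R₁ R₂ r) ^ 2
      = R₁ ^ 2 / normSqS R₁ σ₀ σ₁ (T R₁ R₂ r) := by
  have h1 : R₂ - R₁ ≠ 0 := by linarith [hr.1, hr.2]
  have h2 : R₂ - r ≠ 0 := by linarith [hr.2]
  have h3 : 1 - τ R₁ R₂ r = (R₂ - r) / (R₂ - R₁) := by
    rw [τ]
    field_simp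
    ring
  have h4 : 1 - τ R₁ R₂ r ≠ 0 := by
    rw [h3]
    exact div_ne_zero h2 h1
  rw [← τ_div_one_sub_τ hr, h, normSqS]
  have h5 : (R₁ * (1 - τ R₁ R₂ r) + σ₁ * (R₂ - R₁) * τ R₁ R₂ r) ^ 2
      + σ₀ ^ 2 * (R₂ - R₁) ^ 2 * τ R₁ R₂ r ^ 2
      = ((R₁ + σ₁ * ((R₂ - R₁) * (τ R₁ R₂ r / (1 - τ R₁ R₂ r)))) ^ 2
        + σ₀ ^ 2 * ((R₂ - R₁) * (τ R₁ R₂ r / (1 - τ R₁ R₂ r))) ^ 2) * (1 - τ R₁ R₂ r) ^ 2 := by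
    field_simp
  rw [h5, div_mul_eq_mul_div, mul_div_mul_right _ _ (pow_ne_zero 2 h4)]

lemma circleEnergy_nonneg (U : ℂ → ℂ) (r : ℝ) : 0 ≤ circleEnergy U r :=
  intervalIntegral.integral_nonneg Real.two_pi_pos.le fun _ _ => sq_nonneg _

/-- The decay of the energy on circles in the layer. -/
theorem IsSolution.circleEnergy_le {k R₁ R₂ σ₀ σ₁ : ℝ} (hk : 0 < k) (hR₁ : 0 < R₁)
    (hR : R₁ < R₂) (hσ₀ : 0 < σ₀) (hσ₁ : 0 < σ₁) {D : Set ℂ}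
    (hD : closure D ⊆ Metric.ball 0 R₁) {f G U : ℂ → ℂ}
    (hfsupp : ∀ᵐ z : ℂ, R₁ < ‖z‖ → f z = 0) (hU : IsSolution k R₁ R₂ σ₀ σ₁ D f G U) {r : ℝ}
    (hr : r ∈ Ico R₁ R₂) :
    circleEnergy U r
      ≤ Real.exp (-(2 * decay k R₁ σ₀ σ₁ 0 (T R₁ R₂ r))) * circleEnergy U R₁ := by
  rcases hr.1.eq_or_lt with rfl | hlt
  · have h0 : T R₁ R₂ R₁ = 0 := by simp [T]
    simp [h0, decay]
  obtain ⟨M, r₀, hr₀, hM⟩ := hU.bounded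
  have hmode : ∀ n : ℤ, ‖mode U n r‖ ^ 2
      ≤ Real.exp (-(2 * decay k R₁ σ₀ σ₁ 0 (T R₁ R₂ r))) * ‖mode U n R₁‖ ^ 2 := fun n => by
    refine (hU.isVeryWeakRadialSolution hR₁ hR hσ₀ hD hfsupp n).norm_sq_le hk hR₁ hσ₀ hσ₁
      (continuousOn_mode hR₁ hU.continuousOn n) (M := M * |2 * Real.pi - 0|) (max_lt hr₀ hR)
      (fun s hs => ?_) ⟨hlt, hr.2⟩
    refine norm_mode_le (hR₁.trans ((le_max_right _ _).trans_lt hs.1)) (fun z hz => ?_) n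
    exact hM z (by rw [hz]; exact (le_max_left _ _).trans_lt hs.1) (by rw [hz]; exact hs.2)
  have s1 := hasSum_norm_sq_mode (continuous_circle hR₁ hU.continuousOn hr)
  have s2 := (hasSum_norm_sq_mode (continuous_circle hR₁ hU.continuousOn
    ⟨le_rfl, hR⟩)).mul_left (Real.exp (-(2 * decay k R₁ σ₀ σ₁ 0 (T R₁ R₂ r))))
  -- The decay factor is the same for every mode, so the Parseval series are compared term by term.
  have h1 := hasSum_le (fun n => by
    have := mul_le_mul_of_nonneg_left (hmode (-n)) (sq_nonneg (1 / (2 * Real.pi)))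
    linarith) s1 s2
  have hpi := Real.two_pi_pos
  rw [mul_left_comm] at h1
  exact le_of_mul_le_mul_left h1 (inv_pos.2 hpi)

/-- Write X = R₁²/|S|². On [0, 1] one has √(1 - X) ≥ 1 - X, and tX ≤ R₁/(2σ₁) because |S|² ≥ (R₁ +
σ₁t)² ≥ 2R₁σ₁t. Dropping the root thus costs a bounded amount, although t tends to infinity. -/
lemma sub_le_decay_zero {k R₁ R₂ σ₀ σ₁ r : ℝ} (hk : 0 < k) (hR₁ : 0 < R₁) (hσ₀ : 0 < σ₀)
    (hσ₁ : 0 < σ₁) (hr : r ∈ Ico R₁ R₂) :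
    k * σ₀ * T R₁ R₂ r - k * σ₀ * (R₁ / (2 * σ₁)) ≤ decay k R₁ σ₀ σ₁ 0 (T R₁ R₂ r) := by
  rw [decay_zero_eq hk hR₁ hσ₀ hσ₁ hr]
  have ht := T_nonneg hr
  set t := T R₁ R₂ r
  set X := R₁ ^ 2 / normSqS R₁ σ₀ σ₁ t with hX
  have hN : 0 < normSqS R₁ σ₀ σ₁ t := by
    unfold normSqS
    positivity
  have hX0 : 0 ≤ X := by positivity
  have hX1 : X ≤ 1 := by
    rw [hX, div_le_one hN, normSqS]
    have : 0 ≤ σ₁ * t := by positivity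
    have : 0 ≤ σ₀ ^ 2 * t ^ 2 := by positivity
    nlinarith
  have hs : 1 - X ≤ Real.sqrt (1 - X) := by
    apply Real.le_sqrt_of_sq_le
    nlinarith
  have htX : t * X ≤ R₁ / (2 * σ₁) := by
    rw [hX, mul_div_assoc', div_le_div_iff₀ hN (by positivity), normSqS]
    have h1 : 0 ≤ R₁ * ((R₁ ^ 2 + (σ₁ * t) ^ 2) + σ₀ ^ 2 * t ^ 2) := by positivity
    nlinarith
  have hks : 0 < k * σ₀ := mul_pos hk hσ₀
  calc k * σ₀ * t - k * σ₀ * (R₁ / (2 * σ₁)) ≤ k * σ₀ * t - k * σ₀ * (t * X) := by gcongr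
    _ = k * σ₀ * t * (1 - X) := by ring
    _ ≤ _ := by gcongr

end PAL

theorem theorem3p2 (k R₁ R₂ σ₀ σ₁ : ℝ) (hk : 0 < k) (hR₁ : 0 < R₁) (hR₂ : R₁ < R₂)
    (hσ₀ : 0 < σ₀) (hσ₁ : 0 < σ₁)
    (D : Set ℂ) (hD : closure D ⊆ Metric.ball 0 R₁)
    (f : ℂ → ℂ) (hf : MemLp f 2 (volume.restrict (closure D)ᶜ))
    (hfsupp : ∀ᵐ z : ℂ, R₁ < ‖z‖ → f z = 0)
    (G : ℂ → ℂ) (hG : PAL.MemH1 univ G)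
    (U : ℂ → ℂ) (hU : PAL.IsSolution k R₁ R₂ σ₀ σ₁ D f G U) :
    (∀ r ∈ Ico R₁ R₂,
      PAL.circleEnergy U r ≤
        Real.exp (-(2 * σ₀ * (R₂ - R₁) * k * (PAL.τ R₁ R₂ r / (1 - PAL.τ R₁ R₂ r)) *
          Real.sqrt (1 - PAL.h R₁ R₂ σ₀ σ₁ (PAL.τ R₁ R₂ r) * (1 - PAL.τ R₁ R₂ r) ^ 2)))
          * PAL.circleEnergy U R₁) ∧
    PAL.circleEnergy U =O[𝓝[<] R₂]
      fun r => Real.exp (-(2 * σ₀ * (R₂ - R₁) * k / (1 - PAL.τ R₁ R₂ r))) := by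
  have hτ : ∀ r ∈ Ico R₁ R₂, 2 * σ₀ * (R₂ - R₁) * k * (PAL.τ R₁ R₂ r / (1 - PAL.τ R₁ R₂ r))
      = 2 * (k * σ₀ * PAL.T R₁ R₂ r) := fun r hr => by
    rw [← PAL.τ_div_one_sub_τ hr]
    ring
  refine ⟨fun r hr => ?_, ?_⟩
  · rw [PAL.h_mul_one_sub_τ_sq hr, hτ r hr, mul_assoc 2, ← PAL.decay_zero_eq hk hR₁ hσ₀ hσ₁ hr]
    exact hU.circleEnergy_le hk hR₁ hR₂ hσ₀ hσ₁ hD hfsupp hr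
  -- The constant collects the loss from replacing the root by 1 and the shift in τ/(1-τ) = 1/(1-τ)
  -- - 1.
  · refine IsBigO.of_bound (Real.exp (2 * (k * σ₀ * (R₁ / (2 * σ₁)) + σ₀ * (R₂ - R₁) * k))
      * PAL.circleEnergy U R₁) ?_
    filter_upwards [Ico_mem_nhdsLT hR₂] with r hr
    have h2 : 2 * σ₀ * (R₂ - R₁) * k / (1 - PAL.τ R₁ R₂ r)
        = 2 * (k * σ₀ * PAL.T R₁ R₂ r) + 2 * (σ₀ * (R₂ - R₁) * k) := by
      have h3 : 1 - PAL.τ R₁ R₂ r ≠ 0 := by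
        have : PAL.τ R₁ R₂ r < 1 := by
          rw [PAL.τ, div_lt_one (by linarith)]
          linarith [hr.2]
        linarith
      rw [← hτ r hr]
      field_simp
      ring
    rw [Real.norm_of_nonneg (PAL.circleEnergy_nonneg U r), Real.norm_of_nonneg (Real.exp_pos _).le,
      h2]
    refine (hU.circleEnergy_le hk hR₁ hR₂ hσ₀ hσ₁ hD hfsupp hr).trans ?_
    rw [mul_right_comm, ← Real.exp_add]
    refine mul_le_mul_of_nonneg_right (Real.exp_le_exp.2 ?_) (PAL.circleEnergy_nonneg U R₁)
    linarith [PAL.sub_le_decay_zero hk hR₁ hσ₀ hσ₁ hr]
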